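/- **Theorem 1.** *Setting.* Consider a rectilinear shock wave $x_1=0$ in 2D compressible isentropic inviscid Hookean elastodynamics with smooth equation of state $p=p(\rho)$: two constant states with densities $\rho^\pm>0$, $\rho^+\ne\rho^-$, velocities $(v_1^\pm,0)$, $v_1^\pm>0$, and deformation gradients $F^\pm=(F^\pm_{ij})_{i,j=1,2}$ ($-$ ahead of the shock, in $x_1<0$; $+$ behind it, in $x_1>0$), hyperbolic in the sense that $p'(\rho^\pm)>0$, and satisfying the Rankine–Hugoniot conditions $$\frac{\rho^+}{\rho^-}=\frac{v_1^-}{v_1^+},\quad \frac{\rho^+}{\rho^-}\big\{(v_1^+)^2-(F_{11}^+)^2-(F_{12}^+)^2\big\}(\rho^+-\rho^-)=p(\rho^+)-p(\rho^-),\quad F_{2j}^+=F_{2j}^-,\quad \rho^+F_{1j}^+=\rho^-F_{1j}^-\quad(j=1,2).$$ Put $c^\pm=\sqrt{p'(\rho^\pm)}$, $M_-=v_1^- /c^-$, $M=v_1^+/c^+$, $R=\rho^+/\rho^-$, $\mathcal F_{ij}=F_{ij}^+/c^+$, $M_1=\sqrt{\mathcal F_{11}^2+\mathcal F_{12}^2}$,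 $M_2=\sqrt{\mathcal F_{21}^2+\mathcal F_{22}^2}$, $M_*=\sqrt{1+M_1^2}$, $\ell_0=\mathcal F_{11}\mathcal F_{21}+\mathcal F_{12}\mathcal F_{22}$, and suppose that the Lax conditions $$M_->\frac{M}{\sqrt{M^2-M_1^2}},\qquad M_1<M<M_*$$ hold. Put also $\beta=\sqrt{M_*^2-M^2}$, $d_0=\frac{M_*^2+M^2}{2M^2}$, $a_0=-\frac{\beta^2R}{2M^2}$, $\sigma=\sqrt{M_*^2(1+M_2^2)-\ell_0^2}$. *Linearized problem.* With $L=\partial_t+\partial_1$ and $\mathcal F_j=(\mathcal F_{1j},\mathcal F_{2j})$, the linearized problem for the (dimensionless) perturbation $U=(p,v,F_1,F_2)$ behind the shock, $F_j=(F_{1j},F_{2j})$, and the front perturbation $\varphi$ is $$Lp+\operatorname{div}v=0,\quad M^2Lv+\nabla p-\sum_{j=1}^2(\mathcal F_j\cdot\nabla)F_j=0,\quad LF_j-(\mathcal F_j\cdot\nabla)v=0\ \ (j=1,2)\qquad\text{for }x_1>0,$$ $$v_1+d_0p-\tfrac{\ell_0}{M^2R}v_2=0,\quad a_0p+(1-R)\big(\partial_t-\tfrac{\ell_0}{M^2}\partial_2\big)\varphi=0,\quad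 v_2+(1-R)\partial_2\varphi=0,$$ $$F_{1j}+\mathcal F_{1j}p-\tfrac{\mathcal F_{2j}}{R}v_2=0,\quad F_{2j}-\mathcal F_{1j}v_2=0\ \ (j=1,2)\qquad\text{on }x_1=0.$$ Write the interior system as $\mathcal A_0\partial_tU+\mathcal A_1\partial_1U+\mathcal A_2\partial_2U=0$ (with symmetric matrices $\mathcal A_\alpha$) and the boundary conditions as $BU+b_0\partial_t\varphi+b_2\partial_2\varphi=0$. For $s\in\mathbb C$, $\operatorname{Re}s>0$, and $\omega\in\mathbb R$ let $E^-(s,\omega)\subset\mathbb C^7$ be the sum of the generalized eigenspaces of $-\mathcal A_1^{-1}(s\mathcal A_0+i\omega\mathcal A_2)$ for the eigenvalues with negative real part (the boundary values of the decaying normal modes). The problem satisfies the *Lopatinski condition* if, for all $\operatorname{Re}s>0$ and $\omega\in\mathbb R$, the only $V\in E^-(s,\omega)$, $\chi\in\mathbb C$ with $BV+\chi(sb_0+i\omega b_2)=0$ are $V=0$, $\chi=0$; it satisfies the *uniform Lopatinski condition* if there is $c>0$ with $|BV+\chi(sb_0+i\omega b_2)|\ge c(|V|+|\chi|)$ for all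 $\operatorname{Re}s>0$, $\omega\in\mathbb R$ with $|s|^2+\omega^2=1$ and all $V\in E^-(s,\omega)$, $\chi\in\mathbb C$. The shock is *uniformly stable* if the uniform Lopatinski condition holds, *weakly stable* if the Lopatinski condition holds but the uniform one does not, and *violently unstable* if the Lopatinski condition fails. *Claim.* The shock is uniformly stable if and only if $$\begin{aligned}&(1+\mathcal F_{11}^2+\mathcal F_{12}^2+M^2)\big(1+(\mathcal F:\mathcal F)+(\det\mathcal F)^2\big)\\&\quad-\big\{R(M^2-\mathcal F_{11}^2-\mathcal F_{12}^2)+\mathcal F_{21}^2+\mathcal F_{22}^2\big\}(1+\mathcal F_{11}^2+\mathcal F_{12}^2)^2+\ell_0^2\big\{2(1+\mathcal F_{11}^2+\mathcal F_{12}^2)-M^2\big\}\\&\qquad>2M|\ell_0|\sqrt{(1+\mathcal F_{11}^2+\mathcal F_{12}^2-M^2)\big(1+(\mathcal F:\mathcal F)+(\det\mathcal F)^2\big)},\end{aligned}\tag{$*$}$$ where $\mathcal F:\mathcal F=\sum_{i,j}\mathcal F_{ij}^2$. Inequality $(*)$ is equivalent to $K<K_1+K_2$ with $$K=R(M^2-M_1^2)+M_2^2,\qquad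 K_1=\frac{(M\sigma-|\ell_0|\beta)^2}{M_*^4},\qquad K_2=1+M_2^2.$$ If $(*)$ fails, the shock is weakly stable. In particular, the shock is never violently unstable. -/

import Mathlib

noncomputable section

/-! ## Linearized shock problems on a half-space and the Lopatinski conditions -/

/-- A constant-coefficient linearized shock problem in the half-plane `x₁ > 0`, for an unknown
vector `U(t, x)` with components indexed by `ι` and a scalar front perturbation `φ(t, x₂)`:
`A₀ ∂ₜU + A₁ ∂₁U + A₂ ∂₂U = 0` for `x₁ > 0`, and
`B U + b₀ ∂ₜφ + b₂ ∂₂φ = 0` on `x₁ = 0` (one equation for each element of `κ`). -/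
structure LinearizedShockProblem (ι κ : Type) where
  A₀ : Matrix ι ι ℝ
  A₁ : Matrix ι ι ℝ
  A₂ : Matrix ι ι ℝ
  B : Matrix κ ι ℝ
  b₀ : κ → ℝ
  b₂ : κ → ℝ

namespace LinearizedShockProblem

variable {ι κ : Type} [Fintype ι] [DecidableEq ι]

/-- The matrix `-A₁⁻¹ (s A₀ + i ω A₂)`: the normal mode `exp (s t + i ω x₂) V(x₁)` solves the
interior equations if and only if `V' = interiorSymbol s ω V` (for invertible `A₁`). -/
def interiorSymbol (P : LinearizedShockProblem ι κ) (s : ℂ) (ω : ℝ) : Matrix ι ι ℂ :=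
  -((P.A₁.map (algebraMap ℝ ℂ))⁻¹ *
    (s • P.A₀.map (algebraMap ℝ ℂ) + (Complex.I * ω) • P.A₂.map (algebraMap ℝ ℂ)))

/-- The stable subspace `E⁻(s, ω)`: the sum of the generalized eigenspaces of the interior symbol
for the eigenvalues with negative real part, that is, the space of boundary values `V(0)` of the
normal modes that decay as `x₁ → +∞`. -/
def stableSubspace (P : LinearizedShockProblem ι κ) (s : ℂ) (ω : ℝ) : Submodule ℂ (ι → ℂ) :=
  ⨆ μ ∈ {μ : ℂ | μ.re < 0},
    Module.End.maxGenEigenspace (Matrix.toLin' (P.interiorSymbol s ω)) μ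

/-- The boundary operator on normal modes with amplitudes `V` (of `U` at `x₁ = 0`) and `χ`
(of the front): `B V + χ (s b₀ + i ω b₂)`. -/
def boundarySymbol (P : LinearizedShockProblem ι κ) (s : ℂ) (ω : ℝ) (V : ι → ℂ) (χ : ℂ) :
    κ → ℂ :=
  (P.B.map (algebraMap ℝ ℂ)).mulVec V +
    fun k => χ * (s * (P.b₀ k : ℂ) + Complex.I * ω * (P.b₂ k : ℂ))

/-- The Lopatinski condition: for `η = Re s > 0` and real `ω` there is no nontrivial decaying
normal mode. -/
def LopatinskiCondition (P : LinearizedShockProblem ι κ) : Prop :=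
  ∀ (s : ℂ) (ω : ℝ), 0 < s.re →
    ∀ V ∈ P.stableSubspace s ω, ∀ χ : ℂ, P.boundarySymbol s ω V χ = 0 → V = 0 ∧ χ = 0

/-- The uniform (Kreiss–Lopatinski) condition: the boundary operator is bounded below on the
decaying normal modes, uniformly over the frequencies `(s, ω)` with `Re s > 0` in the unit
hemisphere. -/
def UniformLopatinskiCondition [Fintype κ] (P : LinearizedShockProblem ι κ) : Prop :=
  ∃ c : ℝ, 0 < c ∧ ∀ (s : ℂ) (ω : ℝ), 0 < s.re → ‖s‖ ^ 2 + ω ^ 2 = 1 →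
    ∀ V ∈ P.stableSubspace s ω, ∀ χ : ℂ, c * (‖V‖ + ‖χ‖) ≤ ‖P.boundarySymbol s ω V χ‖

end LinearizedShockProblem

/-! ## Rectilinear shocks in 2D compressible isentropic Hookean elastodynamics -/

/-- A rectilinear shock wave `x₁ = 0` (in a reference frame in which the front is at rest and the
tangential velocities vanish): two constant states with density `ρ`, normal velocity `v₁ > 0` and
deformation gradient `F`, ahead of (`ahead`, `x₁ < 0`) and behind (`behind`, `x₁ > 0`) the front,
and an equation of state `p = p(ρ)`. The states are in the hyperbolicity domain `ρ > 0`,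
`p'(ρ) > 0` and satisfy the Rankine–Hugoniot conditions, and the density has a nonzero jump. -/
structure RectilinearShock where
  /-- the equation of state `p = p(ρ)` -/
  p : ℝ → ℝ
  p_smooth : ContDiffOn ℝ (⊤ : ℕ∞) p (Set.Ioi 0)
  ρahead : ℝ
  ρbehind : ℝ
  vahead : ℝ
  vbehind : ℝ
  Fahead : Matrix (Fin 2) (Fin 2) ℝ
  Fbehind : Matrix (Fin 2) (Fin 2) ℝ
  ρahead_pos : 0 < ρahead
  ρbehind_pos : 0 < ρbehind
  vahead_pos : 0 < vahead
  vbehind_pos : 0 < vbehind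
  hyperbolic_ahead : 0 < deriv p ρahead
  hyperbolic_behind : 0 < deriv p ρbehind
  jump_density : ρbehind ≠ ρahead
  rh_mass : ρbehind / ρahead = vahead / vbehind
  rh_momentum : ρbehind / ρahead * (vbehind ^ 2 - (Fbehind 0 0 ^ 2 + Fbehind 0 1 ^ 2)) *
    (ρbehind - ρahead) = p ρbehind - p ρahead
  rh_tangential : ∀ j, Fbehind 1 j = Fahead 1 j
  rh_normal : ∀ j, ρbehind * Fbehind 0 j = ρahead * Fahead 0 j

namespace RectilinearShock

variable (S : RectilinearShock)

/-- Sound speed ahead of the shock. -/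
def cahead : ℝ := √(deriv S.p S.ρahead)

/-- Sound speed behind the shock. -/
def cbehind : ℝ := √(deriv S.p S.ρbehind)

/-- Upstream Mach number. -/
def Mahead : ℝ := S.vahead / S.cahead

/-- Downstream Mach number. -/
def M : ℝ := S.vbehind / S.cbehind

/-- Ratio of the downstream and upstream densities. -/
def R : ℝ := S.ρbehind / S.ρahead

/-- Scaled deformation gradient `𝓕` behind the shock (`𝓕ᵢⱼ` is `S.F (i-1) (j-1)`). -/
def F : Matrix (Fin 2) (Fin 2) ℝ := fun i j => S.Fbehind i j / S.cbehind

def M₁ : ℝ := √(S.F 0 0 ^ 2 + S.F 0 1 ^ 2)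

def M₂ : ℝ := √(S.F 1 0 ^ 2 + S.F 1 1 ^ 2)


def Mstar : ℝ := √(1 + S.F 0 0 ^ 2 + S.F 0 1 ^ 2)

def ℓ₀ : ℝ := S.F 0 0 * S.F 1 0 + S.F 0 1 * S.F 1 1

def β : ℝ := √(S.Mstar ^ 2 - S.M ^ 2)

def d₀ : ℝ := (S.Mstar ^ 2 + S.M ^ 2) / (2 * S.M ^ 2)

def a₀ : ℝ := -(S.β ^ 2 * S.R / (2 * S.M ^ 2))

def σ : ℝ := √(S.Mstar ^ 2 * (1 + S.M₂ ^ 2) - S.ℓ₀ ^ 2)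

def K : ℝ := S.R * (S.M ^ 2 - S.M₁ ^ 2) + S.M₂ ^ 2

def K₁ : ℝ := (S.M * S.σ - |S.ℓ₀| * S.β) ^ 2 / S.Mstar ^ 4

def K₂ : ℝ := 1 + S.M₂ ^ 2

/-- The Lax 1-shock conditions. -/
def LaxConditions : Prop :=
  S.M / √(S.M ^ 2 - S.M₁ ^ 2) < S.Mahead ∧ S.M₁ < S.M ∧ S.M < S.Mstar

/-- The dimensionless linearized problem for the perturbation
`U = (p, v₁, v₂, F₁₁, F₂₁, F₁₂, F₂₂)` behind the shock and for the front `φ`.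
With `L = ∂ₜ + ∂₁`, the interior equations are
`L p + div v = 0`, `M² L v + ∇p - (𝓕₁·∇)F₁ - (𝓕₂·∇)F₂ = 0`, `L Fⱼ - (𝓕ⱼ·∇)v = 0`,
where `𝓕ⱼ` and `Fⱼ` are the `j`-th columns. The boundary conditions are, in this order,
`v₁ + d₀ p - ℓ₀/(M²R) v₂ = 0`,
`a₀ p + (1-R)(∂ₜφ - ℓ₀/M² ∂₂φ) = 0`,
`v₂ + (1-R) ∂₂φ = 0`,
`F₁ⱼ + 𝓕₁ⱼ p - 𝓕₂ⱼ/R v₂ = 0` (`j = 1, 2`), `F₂ⱼ - 𝓕₁ⱼ v₂ = 0` (`j = 1, 2`). -/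
def linearizedProblem : LinearizedShockProblem (Fin 7) (Fin 7) where
  A₀ := Matrix.diagonal ![1, S.M ^ 2, S.M ^ 2, 1, 1, 1, 1]
  A₁ := !![1, 1, 0, 0, 0, 0, 0;
           1, S.M ^ 2, 0, -S.F 0 0, 0, -S.F 0 1, 0;
           0, 0, S.M ^ 2, 0, -S.F 0 0, 0, -S.F 0 1;
           0, -S.F 0 0, 0, 1, 0, 0, 0;
           0, 0, -S.F 0 0, 0, 1, 0, 0;
           0, -S.F 0 1, 0, 0, 0, 1, 0;
           0, 0, -S.F 0 1, 0, 0, 0, 1]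
  A₂ := !![0, 0, 1, 0, 0, 0, 0;
           0, 0, 0, -S.F 1 0, 0, -S.F 1 1, 0;
           1, 0, 0, 0, -S.F 1 0, 0, -S.F 1 1;
           0, -S.F 1 0, 0, 0, 0, 0, 0;
           0, 0, -S.F 1 0, 0, 0, 0, 0;
           0, -S.F 1 1, 0, 0, 0, 0, 0;
           0, 0, -S.F 1 1, 0, 0, 0, 0]
  B := !![S.d₀, 1, -(S.ℓ₀ / (S.M ^ 2 * S.R)), 0, 0, 0, 0;
          S.a₀, 0, 0, 0, 0, 0, 0;
          0, 0, 1, 0, 0, 0, 0;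
          S.F 0 0, 0, -(S.F 1 0 / S.R), 1, 0, 0, 0;
          S.F 0 1, 0, -(S.F 1 1 / S.R), 0, 0, 1, 0;
          0, 0, -S.F 0 0, 0, 1, 0, 0;
          0, 0, -S.F 0 1, 0, 0, 0, 1]
  b₀ := ![0, 1 - S.R, 0, 0, 0, 0, 0]
  b₂ := ![0, -((1 - S.R) * (S.ℓ₀ / S.M ^ 2)), 1 - S.R, 0, 0, 0, 0]

/-- Uniform stability of the shock. -/
def UniformlyStable : Prop := S.linearizedProblem.UniformLopatinskiCondition

/-- Weak stability of the shock: the Lopatinski condition holds, the uniform one does not. -/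
def WeaklyStable : Prop :=
  S.linearizedProblem.LopatinskiCondition ∧ ¬ S.linearizedProblem.UniformLopatinskiCondition

/-- Violent instability of the shock: the Lopatinski condition fails. -/
def ViolentlyUnstable : Prop := ¬ S.linearizedProblem.LopatinskiCondition

/-- The explicit stability inequality. -/
def StabilityInequality : Prop :=
  (1 + S.F 0 0 ^ 2 + S.F 0 1 ^ 2 + S.M ^ 2) * (1 + (∑ i, ∑ j, S.F i j ^ 2) + S.F.det ^ 2)
    - (S.R * (S.M ^ 2 - S.F 0 0 ^ 2 - S.F 0 1 ^ 2) + S.F 1 0 ^ 2 + S.F 1 1 ^ 2)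
      * (1 + S.F 0 0 ^ 2 + S.F 0 1 ^ 2) ^ 2
    + (S.F 0 0 * S.F 1 0 + S.F 0 1 * S.F 1 1) ^ 2
      * (2 * (1 + S.F 0 0 ^ 2 + S.F 0 1 ^ 2) - S.M ^ 2)
  > 2 * S.M * |S.F 0 0 * S.F 1 0 + S.F 0 1 * S.F 1 1|
    * √((1 + S.F 0 0 ^ 2 + S.F 0 1 ^ 2 - S.M ^ 2)
        * (1 + (∑ i, ∑ j, S.F i j ^ 2) + S.F.det ^ 2))

end RectilinearShock

end

/-!
For `Re s > 0` the interior symbol has exactly one eigenvalue `μ` in the closed right half-plane, and it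
is simple: the root with `Re μ > 0` of the quadratic acoustic dispersion relation
(`exists_isAcousticRoot`, `IsAcousticRoot.eq_of_re_nonneg`, `eq_smul_acousticMode`). By symmetry of the
matrices its left eigenvector is `A₁ r`, with `r` the acoustic mode, so the six-dimensional stable
subspace is the hyperplane `(A₁ r) · V = 0` (`IsAcousticRoot.mem_stableSubspace_iff`).

The boundary matrix `B` is invertible, so the boundary conditions express `V` through the front
amplitude. Both Lopatinski conditions thereby become statements about one scalar, the pairing of `A₁ r`
with this boundary value, which equals, up to a nonzero constant,
`(s + μ) (β² μ² + ω² (R (M² - M₁²) - 1))` (`IsAcousticRoot.covector_dot_frontMode`).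

This scalar does not vanish for `Re s > 0` (`lopatinskiFactor_ne_zero`): if `R (M² - M₁²) ≥ 1`, the zeros
of the second factor are imaginary, and if `R (M² - M₁²) < 1`, a real positive `μ` would force `Re s < 0`.
Uniformity is decided at `Re s = 0`, where `μ = i ξ` with `β² ξ² = ω² (R (M² - M₁²) - 1)`. Such a `μ` is a
limit of roots from the right half-plane if and only if `β |M_*² ξ + ω ℓ₀| ≥ M σ |ω|`. For `ξ` of the
favourable sign this reads `√(R (M² - M₁²) - 1) ≥ (M σ - |ℓ₀| β) / M_*²`, that is `K ≥ K₁ + K₂`. If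
`K < K₁ + K₂`, compactness of `incomingFrequencies` gives the uniform bound (`uniformlyStable`);
otherwise nearby interior frequencies violate every such bound (`not_uniformlyStable`).
-/

section

open Complex Matrix

/-! ### Square roots in the right half-plane, and stable subspaces that are hyperplanes -/

/-- The branch of `√(w² + c²)` in the closed right half-plane has real part at least that of `w`. -/
lemma re_le_re_of_sq_eq_sq_add {z w : ℂ} {c : ℝ} (h : z ^ 2 = w ^ 2 + (c : ℂ) ^ 2)
    (hz : 0 ≤ z.re) (hw : 0 < w.re) : w.re ≤ z.re := by
  have hre := congrArg Complex.re h
  have him := congrArg Complex.im h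
  simp only [sq, mul_re, mul_im, add_re, add_im, ofReal_re, ofReal_im] at hre him
  by_contra! hlt
  have h1 : z.re * z.im = w.re * w.im := by linarith
  have h2 : w.im ^ 2 ≤ z.im ^ 2 := by
    have h3 : (w.re * w.im) ^ 2 ≤ (w.re * z.im) ^ 2 := by
      rw [← h1, mul_pow, mul_pow]
      gcongr
    rw [mul_pow, mul_pow] at h3
    exact le_of_mul_le_mul_left h3 (by positivity)
  nlinarith [sq_nonneg c]

namespace Module.End

variable {E : Type*} [AddCommGroup E] [Module ℂ E]

/-- If the functional `φ` is a left eigenvector of `T` for an eigenvalue with nonnegative real part,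
then it annihilates the stable subspace of `T`. -/
lemma iSup_maxGenEigenspace_le_ker {T : Module.End ℂ E} {φ : E →ₗ[ℂ] ℂ} {μ : ℂ}
    (hφ : ∀ x, φ (T x) = μ * φ x) (hμ : 0 ≤ μ.re) :
    ⨆ ν ∈ {ν : ℂ | ν.re < 0}, T.maxGenEigenspace ν ≤ LinearMap.ker φ := by
  refine iSup₂_le fun ν hν x hx => ?_
  obtain ⟨k, hk⟩ := (mem_maxGenEigenspace _ _ _).1 hx
  have hpow : ∀ (k : ℕ) (y : E), φ (((T - ν • (1 : Module.End ℂ E)) ^ k) y) =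
      (μ - ν) ^ k * φ y := by
    intro k
    induction k with
    | zero => simp
    | succ k ih => intro y; rw [pow_succ, Module.End.mul_apply, ih]; simp [hφ]; ring
  have hne : μ - ν ≠ 0 := by
    intro h
    rw [sub_eq_zero] at h
    subst h
    exact absurd hμ (not_le.2 hν)
  have := hpow k x
  rw [hk, map_zero] at this
  simpa [hne] using this.symm

/-- If `φ` is a left eigenvector of `T` and no eigenvector of `T` for an eigenvalue with nonnegative
real part lies in `ker φ`, then `ker φ` lies in the stable subspace: `ker φ` is invariant, and every
eigenvalue of the restriction of `T` to it has negative real part. -/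
lemma ker_le_iSup_maxGenEigenspace [FiniteDimensional ℂ E] {T : Module.End ℂ E}
    {φ : E →ₗ[ℂ] ℂ} {μ : ℂ} (hφ : ∀ x, φ (T x) = μ * φ x)
    (h : ∀ (ν : ℂ) (u : E), 0 ≤ ν.re → T u = ν • u → φ u = 0 → u = 0) :
    LinearMap.ker φ ≤ ⨆ ν ∈ {ν : ℂ | ν.re < 0}, T.maxGenEigenspace ν := by
  have hinv : ∀ x ∈ LinearMap.ker φ, T x ∈ LinearMap.ker φ := by
    intro x hx
    rw [LinearMap.mem_ker] at hx ⊢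
    rw [hφ, hx, mul_zero]
  intro x hx
  let T' : Module.End ℂ (LinearMap.ker φ) := T.restrict hinv
  have htop := iSup_maxGenEigenspace_eq_top T'
  have hmem : (⟨x, hx⟩ : LinearMap.ker φ) ∈ ⨆ ν, T'.maxGenEigenspace ν := by
    rw [htop]; trivial
  suffices H : ∀ y : LinearMap.ker φ, y ∈ ⨆ ν, T'.maxGenEigenspace ν →
      (y : E) ∈ ⨆ ν ∈ {ν : ℂ | ν.re < 0}, T.maxGenEigenspace ν from H _ hmem
  intro y hy
  induction hy using Submodule.iSup_induction' with
  | zero => simp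
  | add a b _ _ ha hb => exact Submodule.add_mem _ ha hb
  | mem ν y hy =>
    by_cases hν : ν.re < 0
    · refine Submodule.mem_iSup_of_mem ν (Submodule.mem_iSup_of_mem hν ?_)
      rw [maxGenEigenspace, genEigenspace_restrict] at hy
      exact hy
    · have hnot : ¬ T'.HasEigenvalue ν := by
        intro hev
        obtain ⟨u, hu⟩ := hev.exists_hasEigenvector
        refine hu.2 (Subtype.ext ?_)
        exact h ν u (not_lt.1 hν) (congrArg Subtype.val hu.apply_eq_smul) u.2
      have hy0 : y = 0 := by
        by_contra hne
        obtain ⟨k, hk⟩ := (mem_maxGenEigenspace _ _ _).1 hy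
        refine hnot (hasEigenvalue_of_hasGenEigenvalue (k := k) ?_)
        rw [hasGenEigenvalue_iff]
        intro hbot
        apply hne
        have : y ∈ T'.genEigenspace ν k := by
          rw [mem_genEigenspace_nat]; exact hk
        rw [hbot] at this
        simpa using this
      simp [hy0]

end Module.End

/-! ### The parameters of the shock -/

namespace RectilinearShock

variable (S : RectilinearShock)

lemma M_pos : 0 < S.M := div_pos S.vbehind_pos (Real.sqrt_pos.2 S.hyperbolic_behind)

lemma R_pos : 0 < S.R := div_pos S.ρbehind_pos S.ρahead_pos

lemma R_ne_one : S.R ≠ 1 := fun h => S.jump_density ((div_eq_one_iff_eq S.ρahead_pos.ne').1 h)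

lemma M₁_sq : S.M₁ ^ 2 = S.F 0 0 ^ 2 + S.F 0 1 ^ 2 := Real.sq_sqrt (by positivity)

lemma M₂_sq : S.M₂ ^ 2 = S.F 1 0 ^ 2 + S.F 1 1 ^ 2 := Real.sq_sqrt (by positivity)

lemma Mstar_sq : S.Mstar ^ 2 = 1 + S.F 0 0 ^ 2 + S.F 0 1 ^ 2 := Real.sq_sqrt (by positivity)

lemma Mstar_pos : 0 < S.Mstar := Real.sqrt_pos.2 (by positivity)

/-- The Cauchy–Schwarz inequality for the two rows of `𝓕`. -/
lemma ℓ₀_sq_le : S.ℓ₀ ^ 2 ≤ S.M₁ ^ 2 * S.M₂ ^ 2 := by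
  rw [M₁_sq, M₂_sq, ℓ₀]
  nlinarith [sq_nonneg (S.F 0 0 * S.F 1 1 - S.F 0 1 * S.F 1 0)]

lemma one_le_radicand_σ : 1 ≤ S.Mstar ^ 2 * (1 + S.M₂ ^ 2) - S.ℓ₀ ^ 2 := by
  have h := S.ℓ₀_sq_le
  have h' : S.Mstar ^ 2 = 1 + S.M₁ ^ 2 := by rw [Mstar_sq, M₁_sq]; ring
  rw [h']
  nlinarith [sq_nonneg S.M₁, sq_nonneg S.M₂]

lemma σ_sq : S.σ ^ 2 = S.Mstar ^ 2 * (1 + S.M₂ ^ 2) - S.ℓ₀ ^ 2 :=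
  Real.sq_sqrt (by linarith [S.one_le_radicand_σ])

lemma σ_pos : 0 < S.σ := Real.sqrt_pos.2 (by linarith [S.one_le_radicand_σ])

variable {S}

lemma LaxConditions.M₁_sq_lt (h : S.LaxConditions) : S.M₁ ^ 2 < S.M ^ 2 :=
  pow_lt_pow_left₀ h.2.1 (Real.sqrt_nonneg _) two_ne_zero

lemma LaxConditions.M_sq_lt (h : S.LaxConditions) : S.M ^ 2 < S.Mstar ^ 2 :=
  pow_lt_pow_left₀ h.2.2 S.M_pos.le two_ne_zero

lemma LaxConditions.β_sq (h : S.LaxConditions) : S.β ^ 2 = S.Mstar ^ 2 - S.M ^ 2 :=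
  Real.sq_sqrt (by linarith [h.M_sq_lt])

lemma LaxConditions.β_pos (h : S.LaxConditions) : 0 < S.β :=
  Real.sqrt_pos.2 (by linarith [h.M_sq_lt])

lemma LaxConditions.ℓ₀_sq_le (h : S.LaxConditions) : S.ℓ₀ ^ 2 ≤ S.M ^ 2 * S.M₂ ^ 2 :=
  S.ℓ₀_sq_le.trans (mul_le_mul_of_nonneg_right h.M₁_sq_lt.le (sq_nonneg _))

/-- The base of the square in `K₁` is positive. -/
lemma LaxConditions.lt_M_mul_σ (h : S.LaxConditions) : |S.ℓ₀| * S.β < S.M * S.σ := by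
  have hM := S.M_pos
  have hσ := S.σ_pos
  refine lt_of_pow_lt_pow_left₀ 2 (by positivity) ?_
  rw [mul_pow, mul_pow, sq_abs, h.β_sq, S.σ_sq]
  have h1 := h.ℓ₀_sq_le
  have : 0 < S.Mstar ^ 2 * (S.M ^ 2 * (1 + S.M₂ ^ 2) - S.ℓ₀ ^ 2) := by
    have := S.Mstar_pos
    have : 0 < S.M ^ 2 * (1 + S.M₂ ^ 2) - S.ℓ₀ ^ 2 := by nlinarith
    positivity
  nlinarith

/-- `1 + 𝓕 : 𝓕 + (det 𝓕)² = σ²`, and with this the explicit inequality is `K < K₁ + K₂` multiplied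
by `M_*⁴`. -/
theorem LaxConditions.stabilityInequality_iff (h : S.LaxConditions) :
    S.StabilityInequality ↔ S.K < S.K₁ + S.K₂ := by
  have hs := S.Mstar_pos
  have hσ := S.σ_pos
  have hsum : 1 + (∑ i, ∑ j, S.F i j ^ 2) + S.F.det ^ 2 = S.σ ^ 2 := by
    rw [σ_sq, Mstar_sq, M₂_sq, ℓ₀, Matrix.det_fin_two]
    simp only [Fin.sum_univ_two]
    ring
  have hsqrt : √((1 + S.F 0 0 ^ 2 + S.F 0 1 ^ 2 - S.M ^ 2)
        * (1 + (∑ i, ∑ j, S.F i j ^ 2) + S.F.det ^ 2)) = S.β * S.σ := by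
    rw [hsum, ← Mstar_sq, ← h.β_sq, ← mul_pow]
    exact Real.sqrt_sq (mul_pos h.β_pos hσ).le
  rw [StabilityInequality, hsqrt, hsum, ← S.Mstar_sq,
    show S.F 0 0 * S.F 1 0 + S.F 0 1 * S.F 1 1 = S.ℓ₀ from rfl, K₁, div_add' _ _ _ (by positivity),
    lt_div_iff₀ (by positivity), K, K₂, gt_iff_lt, ← sub_pos, ← sub_pos (b := _ * S.Mstar ^ 4)]
  refine iff_of_eq (congrArg _ ?_)
  have hl := sq_abs S.ℓ₀
  have h1 := S.M₁_sq
  have h2 := S.M₂_sq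
  have h3 := h.β_sq
  have h4 := S.σ_sq
  have e1 : S.M ^ 2 - S.F 0 0 ^ 2 - S.F 0 1 ^ 2 = S.M ^ 2 - S.M₁ ^ 2 := by rw [h1]; ring
  rw [e1, add_assoc (S.R * _), ← h2]
  linear_combination (-S.β ^ 2) * hl - S.ℓ₀ ^ 2 * h3 + S.Mstar ^ 2 * h4

/-! ### The acoustic dispersion relation -/

variable (S) in
/-- The acoustic dispersion relation
`M² (s + μ)² = M_*² μ² + 2 i ω ℓ₀ μ - ω² (1 + M₂²)` for modes `exp (s t + μ x₁ + i ω x₂)`. -/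
def IsAcousticRoot (s : ℂ) (ω : ℝ) (μ : ℂ) : Prop :=
  (S.M : ℂ) ^ 2 * (s + μ) ^ 2 =
    (S.Mstar : ℂ) ^ 2 * μ ^ 2 + 2 * I * ω * S.ℓ₀ * μ - ω ^ 2 * (1 + (S.M₂ : ℂ) ^ 2)

variable {s : ℂ} {ω : ℝ} {μ : ℂ}

lemma σ_sq_complex : (S.σ : ℂ) ^ 2 = (S.Mstar : ℂ) ^ 2 * (1 + (S.M₂ : ℂ) ^ 2) - (S.ℓ₀ : ℂ) ^ 2 := by
  exact_mod_cast congrArg (fun x : ℝ => (x : ℂ)) S.σ_sq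

/-- The dispersion relation after completing the square in `μ`. -/
lemma isAcousticRoot_iff_sq : S.IsAcousticRoot s ω μ ↔
    ((S.Mstar : ℂ) ^ 2 * μ + I * ω * S.ℓ₀) ^ 2 =
      (S.Mstar * S.M * (s + μ)) ^ 2 + ((ω * S.σ : ℝ) : ℂ) ^ 2 := by
  have hA : (S.Mstar : ℂ) ^ 2 ≠ 0 := by exact_mod_cast (pow_pos S.Mstar_pos 2).ne'
  rw [IsAcousticRoot, ← mul_right_inj' hA]
  push_cast
  rw [mul_pow (ω : ℂ), σ_sq_complex]
  constructor <;> intro h <;> linear_combination -h + (ω : ℂ) ^ 2 * S.ℓ₀ ^ 2 * I_sq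

lemma IsAcousticRoot.eq_re (h : S.IsAcousticRoot s ω μ) :
    (S.Mstar ^ 2 * μ.re) ^ 2 - (S.Mstar ^ 2 * μ.im + ω * S.ℓ₀) ^ 2 =
      S.Mstar ^ 2 * S.M ^ 2 * ((s.re + μ.re) ^ 2 - (s.im + μ.im) ^ 2) + ω ^ 2 * S.σ ^ 2 := by
  have := congrArg Complex.re (isAcousticRoot_iff_sq.1 h)
  simp [sq, ← ofReal_mul] at this
  linear_combination this

lemma IsAcousticRoot.eq_im (h : S.IsAcousticRoot s ω μ) :
    μ.re * (S.Mstar ^ 2 * μ.im + ω * S.ℓ₀) = S.M ^ 2 * ((s.re + μ.re) * (s.im + μ.im)) := by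
  have := congrArg Complex.im (isAcousticRoot_iff_sq.1 h)
  simp [sq, ← ofReal_mul] at this
  have hA := (pow_pos S.Mstar_pos 2).ne'
  rw [← mul_right_inj' hA]
  linear_combination this / 2

/-- The real-part comparison in the completed square. It excludes imaginary acoustic roots, and it
leads to their uniqueness in the right half-plane. -/
lemma IsAcousticRoot.M_mul_re_le (h : S.IsAcousticRoot s ω μ) (hs : 0 < s.re) (hμ : 0 ≤ μ.re) :
    S.M * (s.re + μ.re) ≤ S.Mstar * μ.re := by
  have hM := S.M_pos
  have hA := S.Mstar_pos
  have := re_le_re_of_sq_eq_sq_add (isAcousticRoot_iff_sq.1 h)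
    (by simp [sq, ← ofReal_mul]; positivity) (by simp [← ofReal_mul]; positivity)
  simp [sq, ← ofReal_mul] at this
  rw [mul_assoc, mul_assoc] at this
  exact le_of_mul_le_mul_left this hA

lemma IsAcousticRoot.re_pos (h : S.IsAcousticRoot s ω μ) (hs : 0 < s.re) (hμ : 0 ≤ μ.re) :
    0 < μ.re := by
  have h1 := h.M_mul_re_le hs hμ
  have hM := S.M_pos
  have hA := S.Mstar_pos
  refine hμ.lt_of_ne fun h0 => ?_
  rw [← h0] at h1
  nlinarith

lemma isAcousticRoot_iff_quadratic (hLax : S.LaxConditions) : S.IsAcousticRoot s ω μ ↔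
    ((S.β : ℂ) ^ 2) * (μ * μ) + (2 * (I * ω * S.ℓ₀ - S.M ^ 2 * s)) * μ +
      -((S.M : ℂ) ^ 2 * s ^ 2 + ω ^ 2 * (1 + (S.M₂ : ℂ) ^ 2)) = 0 := by
  have hβ : (S.β : ℂ) ^ 2 = S.Mstar ^ 2 - S.M ^ 2 := by
    exact_mod_cast congrArg (fun x : ℝ => (x : ℂ)) hLax.β_sq
  rw [IsAcousticRoot, hβ]
  constructor <;> intro h <;> linear_combination -h

/-- The sum of the two acoustic roots is `2 (M² s - i ω ℓ₀) / β²`, which has positive real part. -/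
lemma exists_isAcousticRoot (hLax : S.LaxConditions) (hs : 0 < s.re) (ω : ℝ) :
    ∃ μ, S.IsAcousticRoot s ω μ ∧ 0 < μ.re := by
  have hβ := hLax.β_pos
  have hβ' : (S.β : ℂ) ^ 2 ≠ 0 := by exact_mod_cast (pow_pos hβ 2).ne'
  simp only [isAcousticRoot_iff_quadratic hLax]
  obtain ⟨z, hz⟩ := IsAlgClosed.exists_pow_nat_eq (discrim ((S.β : ℂ) ^ 2)
    (2 * (I * ω * S.ℓ₀ - S.M ^ 2 * s))
    (-((S.M : ℂ) ^ 2 * s ^ 2 + ω ^ 2 * (1 + (S.M₂ : ℂ) ^ 2)))) two_pos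
  have hroot := quadratic_eq_zero_iff hβ' (hz.symm.trans (sq z))
  by_contra! hcon
  have h1 := hcon _ ((hroot _).2 (Or.inl rfl))
  have h2 := hcon _ ((hroot _).2 (Or.inr rfl))
  have h3 := add_nonpos h1 h2
  rw [← add_re, ← add_div, show -(2 * (I * ω * S.ℓ₀ - S.M ^ 2 * s)) + z +
    (-(2 * (I * ω * S.ℓ₀ - S.M ^ 2 * s)) - z) = 2 * (2 * (S.M ^ 2 * s - I * ω * S.ℓ₀)) by ring,
    mul_div_mul_left _ _ two_ne_zero, ← ofReal_pow S.β, div_ofReal_re] at h3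
  simp [sq, ← ofReal_mul] at h3
  have hM := S.M_pos
  have : 0 < 2 * (S.M * S.M * s.re) / (S.β * S.β) := by positivity
  linarith

/-- Two distinct acoustic roots in the closed right half-plane would each satisfy
`(M_* - M) Re μ ≥ M Re s`, and then their sum would be too large. -/
lemma IsAcousticRoot.eq_of_re_nonneg (hLax : S.LaxConditions) (hs : 0 < s.re) {ν : ℂ}
    (hμ : S.IsAcousticRoot s ω μ) (hν : S.IsAcousticRoot s ω ν) (hμ' : 0 ≤ μ.re)
    (hν' : 0 ≤ ν.re) : μ = ν := by
  by_contra hne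
  have h1 := hμ.M_mul_re_le hs hμ'
  have h2 := hν.M_mul_re_le hs hν'
  rw [isAcousticRoot_iff_quadratic hLax] at hμ hν
  have h3 : (S.β : ℂ) ^ 2 * (μ + ν) = 2 * (S.M ^ 2 * s - I * ω * S.ℓ₀) := by
    apply mul_left_cancel₀ (sub_ne_zero.2 hne)
    linear_combination hμ - hν
  have h4 := congrArg Complex.re h3
  simp [sq, ← ofReal_mul] at h4
  have hβ := hLax.β_sq
  have hlt := hLax.2.2
  have hM := S.M_pos
  have hA := S.Mstar_pos
  have h5 : (S.Mstar - S.M) * (μ.re + ν.re) ≥ 2 * S.M * s.re := by linarith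
  have h6 : (S.Mstar + S.M) * ((S.Mstar - S.M) * (μ.re + ν.re)) = 2 * (S.M * S.M) * s.re := by
    rw [← mul_assoc, show (S.Mstar + S.M) * (S.Mstar - S.M) = S.β * S.β by linarith [sq S.β]]
    linarith
  have h7 : (S.Mstar + S.M) * (2 * S.M * s.re) ≤ 2 * (S.M * S.M) * s.re := by
    rw [← h6]; gcongr
  have : 0 < S.Mstar * (S.M * s.re) := by positivity
  linarith

/-- Real form of `shearSymbol_ne_zero`, with `s + μ = l₁ + i l₂`, `Re μ = x` and the derivative symbols
`a x + i p`, `b x + i q`. Cauchy–Schwarz applied to the imaginary part contradicts the real part. -/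
lemma shear_aux {M a b x l₁ l₂ p q : ℝ} (hM : a ^ 2 + b ^ 2 < M ^ 2) (hx : 0 ≤ x) (hl : x < l₁)
    (hre : M ^ 2 * (l₁ ^ 2 - l₂ ^ 2) = (a * x) ^ 2 + (b * x) ^ 2 - (p ^ 2 + q ^ 2))
    (him : M ^ 2 * (l₁ * l₂) = a * x * p + b * x * q) : False := by
  have h1 : (a * x) ^ 2 + (b * x) ^ 2 < M ^ 2 * l₁ ^ 2 := by
    have h2 : x ^ 2 < l₁ ^ 2 := pow_lt_pow_left₀ hl hx two_ne_zero
    calc (a * x) ^ 2 + (b * x) ^ 2 = (a ^ 2 + b ^ 2) * x ^ 2 := by ring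
      _ ≤ (a ^ 2 + b ^ 2) * l₁ ^ 2 := by gcongr
      _ < M ^ 2 * l₁ ^ 2 := mul_lt_mul_of_pos_right hM (pow_pos (hx.trans_lt hl) 2)
  have h2 : (M ^ 2 * (l₁ * l₂)) ^ 2 ≤ ((a * x) ^ 2 + (b * x) ^ 2) * (p ^ 2 + q ^ 2) := by
    rw [him, ← sub_nonneg]
    have : 0 ≤ (a * x * q - b * x * p) ^ 2 := sq_nonneg _
    linarith
  have hP : 0 ≤ (a * x) ^ 2 + (b * x) ^ 2 := by positivity
  have hB : 0 ≤ p ^ 2 + q ^ 2 := by positivity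
  have hL : 0 ≤ M ^ 2 * l₂ ^ 2 := by positivity
  have hsq : (M ^ 2 * (l₁ * l₂)) ^ 2 = (M ^ 2 * l₁ ^ 2) * (M ^ 2 * l₂ ^ 2) := by ring
  have e1 : M ^ 2 * l₁ ^ 2 - M ^ 2 * l₂ ^ 2 = (a * x) ^ 2 + (b * x) ^ 2 - (p ^ 2 + q ^ 2) := by
    rw [← hre]; ring
  rw [hsq] at h2
  generalize (a * x) ^ 2 + (b * x) ^ 2 = P at *
  generalize p ^ 2 + q ^ 2 = B at *
  generalize M ^ 2 * l₁ ^ 2 = U at *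
  generalize M ^ 2 * l₂ ^ 2 = V at *
  obtain rfl : B = P - U + V := by linarith
  have h3 : (U - P) * (V + P) ≤ 0 := by linarith
  have h4 : V + P ≤ 0 := by
    by_contra! hc
    exact absurd h3 (not_le.2 (mul_pos (sub_pos.2 h1) hc))
  linarith

/-- The shear symbol `M² (s + μ)² - ∑ⱼ (𝓕₁ⱼ μ + i ω 𝓕₂ⱼ)²` has no roots in the closed right
half-plane: shear modes never grow in `x₁`. -/
lemma shearSymbol_ne_zero (hLax : S.LaxConditions) (hs : 0 < s.re) (hμ : 0 ≤ μ.re) :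
    (S.M : ℂ) ^ 2 * (s + μ) ^ 2 - (S.F 0 0 * μ + I * ω * S.F 1 0) ^ 2
      - (S.F 0 1 * μ + I * ω * S.F 1 1) ^ 2 ≠ 0 := by
  intro h
  have hre := congrArg Complex.re h
  have him := congrArg Complex.im h
  simp [sq, ← ofReal_mul] at hre him
  have hlt := hLax.M₁_sq_lt
  rw [M₁_sq] at hlt
  have hM := S.M_pos
  refine shear_aux (M := S.M) (a := S.F 0 0) (b := S.F 0 1) (x := μ.re) (l₁ := s.re + μ.re)
    (l₂ := s.im + μ.im) (p := S.F 0 0 * μ.im + ω * S.F 1 0) (q := S.F 0 1 * μ.im + ω * S.F 1 1)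
    hlt hμ (by linarith) ?_ ?_
  · linear_combination hre
  · linear_combination him / 2

end RectilinearShock

/-! ### The interior and boundary matrices, and the acoustic mode -/

namespace RectilinearShock
variable {S : RectilinearShock} {s : ℂ} {ω : ℝ} {μ : ℂ}

variable (S) in
/-- The amplitude of the acoustic mode `exp (s t + μ x₁ + i ω x₂)`, whose velocity is proportional to
the gradient `(μ, i ω)`, scaled by `s + μ` so that its entries are polynomials. -/
noncomputable def acousticMode (s : ℂ) (ω : ℝ) (μ : ℂ) : Fin 7 → ℂ :=
  ![ω ^ 2 - μ ^ 2, (s + μ) * μ, (s + μ) * (I * ω),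
    (S.F 0 0 * μ + I * ω * S.F 1 0) * μ, (S.F 0 0 * μ + I * ω * S.F 1 0) * (I * ω),
    (S.F 0 1 * μ + I * ω * S.F 1 1) * μ, (S.F 0 1 * μ + I * ω * S.F 1 1) * (I * ω)]

variable (S) in
/-- The vector `A₁ r` for the acoustic mode `r`. Since the matrices are symmetric, at an acoustic
root `μ` it is a left eigenvector of the interior symbol for the eigenvalue `μ`. -/
noncomputable def acousticCovector (s : ℂ) (ω : ℝ) (μ : ℂ) : Fin 7 → ℂ :=
  S.linearizedProblem.A₁.map (algebraMap ℝ ℂ) *ᵥ S.acousticMode s ω μ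

variable (S) in
/-- The boundary value that the boundary conditions prescribe when the front has amplitude `1`. -/
noncomputable def frontMode (s : ℂ) (ω : ℝ) : Fin 7 → ℂ :=
  let p : ℂ := (S.R - 1) * (s - I * ω * S.ℓ₀ / S.M ^ 2) / S.a₀
  let v : ℂ := (S.R - 1) * (I * ω)
  ![p, S.ℓ₀ / (S.M ^ 2 * S.R) * v - S.d₀ * p, v,
    S.F 1 0 / S.R * v - S.F 0 0 * p, S.F 0 0 * v,
    S.F 1 1 / S.R * v - S.F 0 1 * p, S.F 0 1 * v]

lemma A₁_mulVec (u : Fin 7 → ℂ) : S.linearizedProblem.A₁.map (algebraMap ℝ ℂ) *ᵥ u =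
    ![u 0 + u 1, u 0 + S.M ^ 2 * u 1 - S.F 0 0 * u 3 - S.F 0 1 * u 5,
      S.M ^ 2 * u 2 - S.F 0 0 * u 4 - S.F 0 1 * u 6,
      u 3 - S.F 0 0 * u 1, u 4 - S.F 0 0 * u 2, u 5 - S.F 0 1 * u 1, u 6 - S.F 0 1 * u 2] := by
  funext k
  fin_cases k <;> simp [linearizedProblem, mulVec, dotProduct, Fin.sum_univ_succ] <;> ring

lemma symbol_mulVec (s : ℂ) (ω : ℝ) (u : Fin 7 → ℂ) :
    (s • S.linearizedProblem.A₀.map (algebraMap ℝ ℂ) +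
      (I * ω) • S.linearizedProblem.A₂.map (algebraMap ℝ ℂ)) *ᵥ u =
    ![s * u 0 + I * ω * u 2, s * S.M ^ 2 * u 1 - I * ω * (S.F 1 0 * u 3 + S.F 1 1 * u 5),
      s * S.M ^ 2 * u 2 + I * ω * (u 0 - S.F 1 0 * u 4 - S.F 1 1 * u 6),
      s * u 3 - I * ω * S.F 1 0 * u 1, s * u 4 - I * ω * S.F 1 0 * u 2,
      s * u 5 - I * ω * S.F 1 1 * u 1, s * u 6 - I * ω * S.F 1 1 * u 2] := by
  funext k
  fin_cases k <;> simp [linearizedProblem, mulVec, dotProduct, Fin.sum_univ_succ] <;> ring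

lemma B_mulVec (u : Fin 7 → ℂ) : S.linearizedProblem.B.map (algebraMap ℝ ℂ) *ᵥ u =
    ![S.d₀ * u 0 + u 1 - S.ℓ₀ / (S.M ^ 2 * S.R) * u 2, S.a₀ * u 0, u 2,
      S.F 0 0 * u 0 - S.F 1 0 / S.R * u 2 + u 3, S.F 0 1 * u 0 - S.F 1 1 / S.R * u 2 + u 5,
      u 4 - S.F 0 0 * u 2, u 6 - S.F 0 1 * u 2] := by
  funext k
  fin_cases k <;> simp [linearizedProblem, mulVec, dotProduct, Fin.sum_univ_succ] <;> ring

lemma isUnit_A₁ (hLax : S.LaxConditions) :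
    IsUnit (S.linearizedProblem.A₁.map (algebraMap ℝ ℂ)).det := by
  rw [isUnit_iff_ne_zero]
  intro h
  obtain ⟨u, hu, h0⟩ := exists_mulVec_eq_zero_iff.2 h
  refine hu ?_
  rw [A₁_mulVec] at h0
  have e (k : Fin 7) := congrFun h0 k
  have e0 := e 0; have e1 := e 1; have e2 := e 2; have e3 := e 3; have e4 := e 4
  have e5 := e 5; have e6 := e 6
  simp at e0 e1 e2 e3 e4 e5 e6
  have h1 : (S.M : ℂ) ^ 2 - (1 + S.F 0 0 ^ 2 + S.F 0 1 ^ 2) ≠ 0 := by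
    have := hLax.M_sq_lt
    rw [Mstar_sq] at this
    exact_mod_cast (sub_neg.2 this).ne
  have h2 : (S.M : ℂ) ^ 2 - (S.F 0 0 ^ 2 + S.F 0 1 ^ 2) ≠ 0 := by
    have := hLax.M₁_sq_lt
    rw [M₁_sq] at this
    exact_mod_cast (sub_pos.2 this).ne'
  have u1 : u 1 = 0 := by
    apply (mul_eq_zero.1 (?_ : ((S.M : ℂ) ^ 2 - (1 + S.F 0 0 ^ 2 + S.F 0 1 ^ 2)) * u 1 = 0)).resolve_left h1
    linear_combination e1 - e0 + S.F 0 0 * e3 + S.F 0 1 * e5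
  have u2 : u 2 = 0 := by
    apply (mul_eq_zero.1 (?_ : ((S.M : ℂ) ^ 2 - (S.F 0 0 ^ 2 + S.F 0 1 ^ 2)) * u 2 = 0)).resolve_left h2
    linear_combination e2 + S.F 0 0 * e4 + S.F 0 1 * e6
  simp [u1, u2] at e0 e3 e4 e5 e6
  funext k
  fin_cases k <;> simp [*]

lemma a₀_ne_zero (hLax : S.LaxConditions) : S.a₀ ≠ 0 := by
  have := hLax.β_pos
  have := S.M_pos
  have := S.R_pos
  exact neg_ne_zero.2 (by positivity)

lemma isUnit_B (hLax : S.LaxConditions) :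
    IsUnit (S.linearizedProblem.B.map (algebraMap ℝ ℂ)).det := by
  rw [isUnit_iff_ne_zero]
  intro h
  obtain ⟨u, hu, h0⟩ := exists_mulVec_eq_zero_iff.2 h
  refine hu ?_
  rw [B_mulVec] at h0
  have e (k : Fin 7) := congrFun h0 k
  have e0 := e 0; have e1 := e 1; have e2 := e 2; have e3 := e 3; have e4 := e 4
  have e5 := e 5; have e6 := e 6
  simp [a₀_ne_zero hLax] at e0 e1 e2 e3 e4 e5 e6
  simp [e1, e2] at e0 e3 e4 e5 e6
  funext k
  fin_cases k <;> simp [*]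

lemma boundarySymbol_frontMode (hLax : S.LaxConditions) (s : ℂ) (ω : ℝ) :
    S.linearizedProblem.boundarySymbol s ω (S.frontMode s ω) 1 = 0 := by
  have ha : (S.a₀ : ℂ) ≠ 0 := by exact_mod_cast a₀_ne_zero hLax
  rw [LinearizedShockProblem.boundarySymbol, B_mulVec]
  funext k
  fin_cases k <;> simp [frontMode, linearizedProblem] <;> field_simp <;> ring

lemma symbol_symm (s : ℂ) (ω : ℝ) (u v : Fin 7 → ℂ) :
    ((s • S.linearizedProblem.A₀.map (algebraMap ℝ ℂ) +
      (I * ω) • S.linearizedProblem.A₂.map (algebraMap ℝ ℂ)) *ᵥ u) ⬝ᵥ v =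
    u ⬝ᵥ ((s • S.linearizedProblem.A₀.map (algebraMap ℝ ℂ) +
      (I * ω) • S.linearizedProblem.A₂.map (algebraMap ℝ ℂ)) *ᵥ v) := by
  rw [symbol_mulVec, symbol_mulVec]
  simp [dotProduct, Fin.sum_univ_succ]
  ring

lemma A₁_symm (u v : Fin 7 → ℂ) :
    (S.linearizedProblem.A₁.map (algebraMap ℝ ℂ) *ᵥ u) ⬝ᵥ v =
    u ⬝ᵥ (S.linearizedProblem.A₁.map (algebraMap ℝ ℂ) *ᵥ v) := by
  rw [A₁_mulVec, A₁_mulVec]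
  simp [dotProduct, Fin.sum_univ_succ]
  ring

lemma Mstar_sq_complex : (S.Mstar : ℂ) ^ 2 = 1 + S.F 0 0 ^ 2 + S.F 0 1 ^ 2 := by
  exact_mod_cast congrArg (fun x : ℝ => (x : ℂ)) S.Mstar_sq

/-- The dispersion relation says that the shear symbol equals the symbol of the Laplacian. -/
lemma isAcousticRoot_iff : S.IsAcousticRoot s ω μ ↔
    (S.M : ℂ) ^ 2 * (s + μ) ^ 2 - (S.F 0 0 * μ + I * ω * S.F 1 0) ^ 2
      - (S.F 0 1 * μ + I * ω * S.F 1 1) ^ 2 = μ ^ 2 - ω ^ 2 := by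
  have h2 : (S.M₂ : ℂ) ^ 2 = S.F 1 0 ^ 2 + S.F 1 1 ^ 2 := by
    exact_mod_cast congrArg (fun x : ℝ => (x : ℂ)) S.M₂_sq
  rw [IsAcousticRoot, Mstar_sq_complex, h2, ℓ₀]
  push_cast
  constructor <;> intro h
  · linear_combination h - (ω : ℂ) ^ 2 * (S.F 1 0 ^ 2 + S.F 1 1 ^ 2) * I_sq
  · linear_combination h + (ω : ℂ) ^ 2 * (S.F 1 0 ^ 2 + S.F 1 1 ^ 2) * I_sq

lemma IsAcousticRoot.symbol_mulVec (h : S.IsAcousticRoot s ω μ) :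
    (s • S.linearizedProblem.A₀.map (algebraMap ℝ ℂ) +
      (I * ω) • S.linearizedProblem.A₂.map (algebraMap ℝ ℂ)) *ᵥ S.acousticMode s ω μ =
    -μ • S.acousticCovector s ω μ := by
  rw [isAcousticRoot_iff] at h
  rw [RectilinearShock.symbol_mulVec, acousticCovector, A₁_mulVec]
  funext k
  fin_cases k <;> simp [acousticMode]
  · linear_combination (s + μ) * ω ^ 2 * I_sq
  · linear_combination μ * h
  · linear_combination I * ω * h
  all_goals ring

lemma interiorSymbol_eq (hLax : S.LaxConditions) (u : Fin 7 → ℂ) :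
    S.linearizedProblem.A₁.map (algebraMap ℝ ℂ) *ᵥ (S.linearizedProblem.interiorSymbol s ω *ᵥ u) =
    -((s • S.linearizedProblem.A₀.map (algebraMap ℝ ℂ) +
      (I * ω) • S.linearizedProblem.A₂.map (algebraMap ℝ ℂ)) *ᵥ u) := by
  rw [LinearizedShockProblem.interiorSymbol, mulVec_mulVec, mul_neg, ← Matrix.mul_assoc,
    mul_nonsing_inv _ (isUnit_A₁ hLax), Matrix.one_mul, neg_mulVec]

lemma IsAcousticRoot.covector_interiorSymbol (hLax : S.LaxConditions)
    (h : S.IsAcousticRoot s ω μ) (u : Fin 7 → ℂ) :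
    S.acousticCovector s ω μ ⬝ᵥ (S.linearizedProblem.interiorSymbol s ω *ᵥ u) =
      μ * (S.acousticCovector s ω μ ⬝ᵥ u) := by
  conv_lhs => rw [acousticCovector, A₁_symm, interiorSymbol_eq hLax, dotProduct_neg, ← symbol_symm,
    h.symbol_mulVec]
  simp

lemma IsAcousticRoot.covector_dot_mode (h : S.IsAcousticRoot s ω μ) :
    S.acousticCovector s ω μ ⬝ᵥ S.acousticMode s ω μ =
      2 * (μ ^ 2 - ω ^ 2) * (s + μ) *
        (S.M ^ 2 * (s + μ) - (S.Mstar ^ 2 * μ + I * ω * S.ℓ₀)) := by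
  rw [isAcousticRoot_iff] at h
  rw [acousticCovector, A₁_mulVec, Mstar_sq_complex, ℓ₀]
  simp [acousticMode, dotProduct, Fin.sum_univ_succ]
  linear_combination (ω ^ 2 - μ ^ 2) * h + (ω ^ 2 * S.M ^ 2 * (s + μ) ^ 2
    - ω ^ 2 * (S.F 0 0 ^ 2 + S.F 0 1 ^ 2) * (2 * μ * s + μ ^ 2)
    - 2 * ω ^ 3 * s * I * (S.F 0 0 * S.F 1 0 + S.F 0 1 * S.F 1 1)
    + ω ^ 4 * I ^ 2 * (S.F 1 0 ^ 2 + S.F 1 1 ^ 2)) * I_sq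

lemma A₁_mulVec_frontMode (hLax : S.LaxConditions) (s : ℂ) (ω : ℝ) :
    S.linearizedProblem.A₁.map (algebraMap ℝ ℂ) *ᵥ S.frontMode s ω =
      (((S.R : ℂ) - 1) / S.R) • ![s, -(S.M ^ 2 * s - I * ω * S.ℓ₀),
        S.R * (S.M ^ 2 - S.M₁ ^ 2) * (I * ω),
        S.F 1 0 * (I * ω) - S.F 0 0 * s, 0, S.F 1 1 * (I * ω) - S.F 0 1 * s, 0] := by
  have hβ : (S.β : ℂ) ^ 2 = 1 + S.F 0 0 ^ 2 + S.F 0 1 ^ 2 - S.M ^ 2 := by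
    rw [← Mstar_sq_complex]
    exact_mod_cast congrArg (fun x : ℝ => (x : ℂ)) hLax.β_sq
  have h1 : (S.M₁ : ℂ) ^ 2 = S.F 0 0 ^ 2 + S.F 0 1 ^ 2 := by
    exact_mod_cast congrArg (fun x : ℝ => (x : ℂ)) S.M₁_sq
  have hβ0 : (S.β : ℂ) ≠ 0 := by exact_mod_cast hLax.β_pos.ne'
  have hβ1 : (1 + S.F 0 0 ^ 2 + S.F 0 1 ^ 2 - S.M ^ 2 : ℂ) ≠ 0 := by
    rw [← hβ]; exact pow_ne_zero 2 hβ0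
  have hM : (S.M : ℂ) ≠ 0 := by exact_mod_cast S.M_pos.ne'
  have hR : (S.R : ℂ) ≠ 0 := by exact_mod_cast S.R_pos.ne'
  have hd : (S.d₀ : ℂ) = (1 + S.F 0 0 ^ 2 + S.F 0 1 ^ 2 + S.M ^ 2) / (2 * S.M ^ 2) := by
    rw [← Mstar_sq_complex, d₀]; push_cast; ring
  have ha : (S.a₀ : ℂ) = -((1 + S.F 0 0 ^ 2 + S.F 0 1 ^ 2 - S.M ^ 2) * S.R / (2 * S.M ^ 2)) := by
    rw [← hβ, a₀]; push_cast; ring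
  have hl : (S.ℓ₀ : ℂ) = S.F 0 0 * S.F 1 0 + S.F 0 1 * S.F 1 1 := by
    rw [ℓ₀]; push_cast; ring
  rw [A₁_mulVec]
  funext k
  fin_cases k <;> simp [frontMode, hd, ha, h1, hl] <;> field_simp <;> ring

variable (S) in
/-- The factor `β² μ² + ω² (R (M² - M₁²) - 1)` of the Lopatinski determinant that can vanish; the
other factor `s + μ` is the symbol of `L = ∂ₜ + ∂₁` on the acoustic mode. -/
noncomputable def lopatinskiFactor (ω : ℝ) (μ : ℂ) : ℂ :=
  S.β ^ 2 * μ ^ 2 + ω ^ 2 * (S.R * (S.M ^ 2 - S.M₁ ^ 2) - 1)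

/-- The Lopatinski determinant: up to the nonzero constant `(1 - R) / R` it is
`(s + μ) (β² μ² + ω² (R (M² - M₁²) - 1))`. -/
lemma IsAcousticRoot.covector_dot_frontMode (hLax : S.LaxConditions) (h : S.IsAcousticRoot s ω μ) :
    S.acousticCovector s ω μ ⬝ᵥ S.frontMode s ω =
      (1 - S.R) / S.R * ((s + μ) * S.lopatinskiFactor ω μ) := by
  have hβ : (S.β : ℂ) ^ 2 = 1 + S.F 0 0 ^ 2 + S.F 0 1 ^ 2 - S.M ^ 2 := by
    rw [← Mstar_sq_complex]
    exact_mod_cast congrArg (fun x : ℝ => (x : ℂ)) hLax.β_sq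
  rw [isAcousticRoot_iff] at h
  rw [acousticCovector, A₁_symm, A₁_mulVec_frontMode hLax, dotProduct_smul, smul_eq_mul,
    lopatinskiFactor, hβ,
    ← neg_sub (S.R : ℂ) 1, neg_div, neg_mul, ← mul_neg]
  congr 1
  simp [acousticMode, dotProduct, Fin.sum_univ_succ, ℓ₀]
  linear_combination (-μ) * h + ω ^ 2 * (s + μ) * S.R * (S.M ^ 2 - S.M₁ ^ 2) * I_sq

/-- An eigenvector for an eigenvalue in the closed right half-plane is an acoustic mode. Eliminating
the deformation gradient shows that `q u = -u₀ r`, where `q` is the shear symbol and `r` the acoustic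
mode, and that `(q - (μ² - ω²)) u₀ = 0`. -/
lemma eq_smul_acousticMode (hLax : S.LaxConditions) (hs : 0 < s.re) (hμ : 0 ≤ μ.re)
    {u : Fin 7 → ℂ} (hu : S.linearizedProblem.interiorSymbol s ω *ᵥ u = μ • u) (hu0 : u ≠ 0) :
    S.IsAcousticRoot s ω μ ∧ ∃ c : ℂ, c • u = S.acousticMode s ω μ := by
  have hlam : s + μ ≠ 0 := by
    intro h
    have := congrArg Complex.re h
    simp at this
    linarith
  have hq := shearSymbol_ne_zero (ω := ω) hLax hs hμ
  have hsym := interiorSymbol_eq (s := s) (ω := ω) hLax u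
  rw [hu, mulVec_smul, A₁_mulVec, symbol_mulVec] at hsym
  have e (k : Fin 7) := congrFun hsym k
  have e0 := e 0; have e1 := e 1; have e2 := e 2; have e3 := e 3; have e4 := e 4
  have e5 := e 5; have e6 := e 6
  clear e hsym
  simp at e0 e1 e2 e3 e4 e5 e6
  rw [isAcousticRoot_iff]
  set q := (S.M : ℂ) ^ 2 * (s + μ) ^ 2 - (S.F 0 0 * μ + I * ω * S.F 1 0) ^ 2
      - (S.F 0 1 * μ + I * ω * S.F 1 1) ^ 2 with hqdef
  have f0 : (s + μ) * u 0 = -(μ * u 1 + I * ω * u 2) := by linear_combination e0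
  have f3 : (s + μ) * u 3 = (S.F 0 0 * μ + I * ω * S.F 1 0) * u 1 := by linear_combination e3
  have f4 : (s + μ) * u 4 = (S.F 0 0 * μ + I * ω * S.F 1 0) * u 2 := by linear_combination e4
  have f5 : (s + μ) * u 5 = (S.F 0 1 * μ + I * ω * S.F 1 1) * u 1 := by linear_combination e5
  have f6 : (s + μ) * u 6 = (S.F 0 1 * μ + I * ω * S.F 1 1) * u 2 := by linear_combination e6
  have g1 : q * u 1 = -u 0 * ((s + μ) * μ) := by
    linear_combination (s + μ) * e1 + (S.F 0 0 * μ + I * ω * S.F 1 0) * f3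
      + (S.F 0 1 * μ + I * ω * S.F 1 1) * f5
  have g2 : q * u 2 = -u 0 * ((s + μ) * (I * ω)) := by
    linear_combination (s + μ) * e2 + (S.F 0 0 * μ + I * ω * S.F 1 0) * f4
      + (S.F 0 1 * μ + I * ω * S.F 1 1) * f6
  have g3 : q * u 3 = -u 0 * ((S.F 0 0 * μ + I * ω * S.F 1 0) * μ) := by
    apply mul_left_cancel₀ hlam
    linear_combination q * f3 + (S.F 0 0 * μ + I * ω * S.F 1 0) * g1
  have g4 : q * u 4 = -u 0 * ((S.F 0 0 * μ + I * ω * S.F 1 0) * (I * ω)) := by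
    apply mul_left_cancel₀ hlam
    linear_combination q * f4 + (S.F 0 0 * μ + I * ω * S.F 1 0) * g2
  have g5 : q * u 5 = -u 0 * ((S.F 0 1 * μ + I * ω * S.F 1 1) * μ) := by
    apply mul_left_cancel₀ hlam
    linear_combination q * f5 + (S.F 0 1 * μ + I * ω * S.F 1 1) * g1
  have g6 : q * u 6 = -u 0 * ((S.F 0 1 * μ + I * ω * S.F 1 1) * (I * ω)) := by
    apply mul_left_cancel₀ hlam
    linear_combination q * f6 + (S.F 0 1 * μ + I * ω * S.F 1 1) * g2
  have g0 : (q - (μ ^ 2 - ω ^ 2)) * u 0 = 0 := by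
    apply mul_left_cancel₀ hlam
    linear_combination q * f0 - μ * g1 - I * ω * g2 + (s + μ) * u 0 * ω ^ 2 * I_sq
  have h0 : u 0 ≠ 0 := by
    intro h0
    simp only [h0, neg_zero, zero_mul, mul_eq_zero, hq, false_or] at g1 g2 g3 g4 g5 g6
    refine hu0 (funext fun k => ?_)
    fin_cases k <;> assumption
  have hac : q = μ ^ 2 - ω ^ 2 := sub_eq_zero.1 ((mul_eq_zero.1 g0).resolve_right h0)
  refine ⟨hac, -q / u 0, funext fun k => ?_⟩
  rw [Pi.smul_apply, smul_eq_mul, div_mul_eq_mul_div, div_eq_iff h0]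
  fin_cases k <;> simp [acousticMode]
  · rw [hac]; ring
  · linear_combination -g1
  · linear_combination -g2
  · linear_combination -g3
  · linear_combination -g4
  · linear_combination -g5
  · linear_combination -g6

/-- The acoustic eigenvalue in the right half-plane is semisimple. -/
lemma IsAcousticRoot.covector_dot_mode_ne_zero (hLax : S.LaxConditions)
    (h : S.IsAcousticRoot s ω μ) (hs : 0 < s.re) (hμ : 0 ≤ μ.re) :
    S.acousticCovector s ω μ ⬝ᵥ S.acousticMode s ω μ ≠ 0 := by
  have hq := shearSymbol_ne_zero (ω := ω) hLax hs hμ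
  rw [h.covector_dot_mode]
  rw [isAcousticRoot_iff.1 h] at hq
  have hlam : s + μ ≠ 0 := by
    intro h
    have := congrArg Complex.re h
    simp at this
    linarith
  refine mul_ne_zero (mul_ne_zero (mul_ne_zero two_ne_zero hq) hlam) fun h0 => ?_
  have hN := sub_eq_zero.1 h0
  have h1 := congrArg Complex.re hN
  simp [sq, ← ofReal_mul] at h1
  have h2 := h.M_mul_re_le hs hμ
  have hM := S.M_pos
  have hA := S.Mstar_pos
  have hlt := hLax.2.2
  have h3 : S.Mstar * (S.M * (s.re + μ.re)) ≤ S.M * (S.M * (s.re + μ.re)) := by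
    calc _ ≤ S.Mstar * (S.Mstar * μ.re) := by gcongr
      _ = _ := by linarith
  have h4 : S.M * (S.M * (s.re + μ.re)) < S.Mstar * (S.M * (s.re + μ.re)) := by gcongr
  linarith

/-- The stable subspace is the hyperplane annihilated by the acoustic covector of the acoustic root in
the right half-plane. -/
lemma IsAcousticRoot.mem_stableSubspace_iff (hLax : S.LaxConditions)
    (h : S.IsAcousticRoot s ω μ) (hs : 0 < s.re) (hμ : 0 ≤ μ.re) {V : Fin 7 → ℂ} :
    V ∈ S.linearizedProblem.stableSubspace s ω ↔ S.acousticCovector s ω μ ⬝ᵥ V = 0 := by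
  let φ : (Fin 7 → ℂ) →ₗ[ℂ] ℂ := dotProductBilin ℂ ℂ (S.acousticCovector s ω μ)
  have hφ : ∀ x, φ (Matrix.toLin' (S.linearizedProblem.interiorSymbol s ω) x) = μ * φ x :=
    fun x => h.covector_interiorSymbol hLax x
  refine ⟨fun hV => Module.End.iSup_maxGenEigenspace_le_ker hφ hμ hV, fun hV =>
    Module.End.ker_le_iSup_maxGenEigenspace hφ (fun ν u hν hu hφu => ?_) (LinearMap.mem_ker.2 hV)⟩
  by_contra hu0
  obtain ⟨hν', c, hc⟩ := eq_smul_acousticMode hLax hs hν hu hu0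
  obtain rfl := h.eq_of_re_nonneg hLax hs hν' hμ hν
  refine h.covector_dot_mode_ne_zero hLax hs hμ ?_
  rw [← hc, dotProduct_smul, show S.acousticCovector s ω μ ⬝ᵥ u = 0 from hφu, smul_zero]

end RectilinearShock

/-! ### Zeros of the Lopatinski determinant -/

namespace RectilinearShock
variable {S : RectilinearShock} {s : ℂ} {ω : ℝ} {μ : ℂ}

lemma lopatinskiFactor_re : (S.lopatinskiFactor ω μ).re =
    S.β ^ 2 * (μ.re ^ 2 - μ.im ^ 2) + ω ^ 2 * (S.R * (S.M ^ 2 - S.M₁ ^ 2) - 1) := by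
  simp [lopatinskiFactor, sq, ← ofReal_mul]

lemma lopatinskiFactor_im : (S.lopatinskiFactor ω μ).im = 2 * S.β ^ 2 * (μ.re * μ.im) := by
  simp [lopatinskiFactor, sq, ← ofReal_mul]
  ring

lemma re_mul_im_eq_zero (hLax : S.LaxConditions) (h : S.lopatinskiFactor ω μ = 0) :
    μ.re * μ.im = 0 := by
  have := congrArg Complex.im h
  rw [lopatinskiFactor_im] at this
  simpa [hLax.β_pos.ne'] using this

lemma IsAcousticRoot.eq_zero_of_zero (h : S.IsAcousticRoot s 0 0) : s = 0 := by
  have hM := S.M_pos.ne'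
  simpa [IsAcousticRoot, hM] using h

/-- If `R (M² - M₁²) < 1`, a zero of the Lopatinski factor is a positive real `μ`. The dispersion
relation with `Re s ≥ 0` would then bound `ω² (M² M₂² - ℓ₀² + M² R (M² - M₁²))` above by zero. -/
lemma lopatinskiFactor_ne_zero_of_lt_one (hLax : S.LaxConditions) (h : S.IsAcousticRoot s ω μ)
    (hs : 0 ≤ s.re) (hμ : 0 ≤ μ.re) (hne : s ≠ 0 ∨ ω ≠ 0)
    (hR : S.R * (S.M ^ 2 - S.M₁ ^ 2) < 1) : S.lopatinskiFactor ω μ ≠ 0 := by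
  intro hQ
  have hre := congrArg Complex.re hQ
  rw [lopatinskiFactor_re, zero_re] at hre
  have hβ2 := hLax.β_sq
  have hβ : 0 < S.β ^ 2 := pow_pos hLax.β_pos 2
  have hm : 0 < S.R * (S.M ^ 2 - S.M₁ ^ 2) := mul_pos S.R_pos (sub_pos.2 hLax.M₁_sq_lt)
  have hM : 0 < S.M ^ 2 := pow_pos S.M_pos 2
  have hA : 0 < S.Mstar ^ 2 := pow_pos S.Mstar_pos 2
  have hl := hLax.ℓ₀_sq_le
  have hσ := S.σ_sq
  have him := h.eq_im
  have hre' := h.eq_re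
  have hxy := re_mul_im_eq_zero hLax hQ
  have hx : μ.re ≠ 0 := by
    intro hx
    rw [hx] at hre
    have h1 : 0 ≤ S.β ^ 2 * μ.im ^ 2 := by positivity
    have h2 : 0 ≤ ω ^ 2 * (1 - S.R * (S.M ^ 2 - S.M₁ ^ 2)) :=
      mul_nonneg (sq_nonneg _) (sub_nonneg.2 hR.le)
    have h3 : S.β ^ 2 * μ.im ^ 2 = 0 := by linarith
    have h4 : ω ^ 2 * (1 - S.R * (S.M ^ 2 - S.M₁ ^ 2)) = 0 := by linarith
    have hω : ω = 0 := by simpa [(sub_pos.2 hR).ne'] using h4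
    have hy : μ.im = 0 := by simpa [hβ.ne', hLax.β_pos.ne'] using h3
    obtain rfl : μ = 0 := Complex.ext hx hy
    subst hω
    simp [h.eq_zero_of_zero] at hne
  have hy : μ.im = 0 := (mul_eq_zero.1 hxy).resolve_left hx
  have hx0 : 0 < μ.re := hμ.lt_of_ne' hx
  rw [hy] at hre him hre'
  generalize μ.re = x at *
  have hl1 : x ≤ s.re + x := by linarith
  generalize s.re + x = l₁ at *
  generalize s.im + 0 = l₂ at *
  have h1 : (S.M ^ 2) ^ 2 * l₂ ^ 2 ≤ ω ^ 2 * S.ℓ₀ ^ 2 := by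
    have e : l₁ ^ 2 * ((S.M ^ 2) ^ 2 * l₂ ^ 2) = x ^ 2 * (ω ^ 2 * S.ℓ₀ ^ 2) := by
      linear_combination (-(x * (S.Mstar ^ 2 * 0 + ω * S.ℓ₀) + S.M ^ 2 * (l₁ * l₂))) * him
    have e2 : l₁ ^ 2 * ((S.M ^ 2) ^ 2 * l₂ ^ 2) ≤ l₁ ^ 2 * (ω ^ 2 * S.ℓ₀ ^ 2) := by
      rw [e]; gcongr
    exact le_of_mul_le_mul_left e2 (pow_pos (hx0.trans_le hl1) 2)
  have h2 : S.M ^ 2 * (S.M ^ 2 * x ^ 2) ≤ S.M ^ 2 * (S.M ^ 2 * l₁ ^ 2) := by gcongr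
  -- multiply the real part of the dispersion relation by `M² / M_*²`
  have h3 : S.M ^ 2 * (S.Mstar ^ 2 * x ^ 2 - ω ^ 2 * (1 + S.M₂ ^ 2)) =
      S.M ^ 2 * (S.M ^ 2 * l₁ ^ 2) - (S.M ^ 2) ^ 2 * l₂ ^ 2 := by
    apply mul_left_cancel₀ hA.ne'
    rw [hσ] at hre'
    linear_combination S.M ^ 2 * hre'
  have hω : 0 < ω ^ 2 := by
    have : 0 < ω ^ 2 * (1 - S.R * (S.M ^ 2 - S.M₁ ^ 2)) := by
      have : 0 < S.β ^ 2 * x ^ 2 := by positivity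
      linarith
    exact pos_of_mul_pos_left this (sub_pos.2 hR).le
  have h4 : 0 < ω ^ 2 * (S.M ^ 2 * S.M₂ ^ 2 - S.ℓ₀ ^ 2 + S.M ^ 2 * (S.R * (S.M ^ 2 - S.M₁ ^ 2))) :=
    mul_pos hω (by have := mul_pos hM hm; linarith)
  rw [hβ2] at hre
  have h5 : S.M ^ 2 * ((S.Mstar ^ 2 - S.M ^ 2) * (x ^ 2 - 0 ^ 2) +
    ω ^ 2 * (S.R * (S.M ^ 2 - S.M₁ ^ 2) - 1)) = 0 := by rw [hre, mul_zero]
  linarith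

lemma lopatinskiFactor_eq_zero_imp (hLax : S.LaxConditions)
    (hQ : S.lopatinskiFactor ω μ = 0) (hR : 1 ≤ S.R * (S.M ^ 2 - S.M₁ ^ 2)) :
    μ.re = 0 ∧ (S.β * μ.im) ^ 2 = ω ^ 2 * (S.R * (S.M ^ 2 - S.M₁ ^ 2) - 1) := by
  have hre := congrArg Complex.re hQ
  rw [lopatinskiFactor_re, zero_re] at hre
  have hβ : 0 < S.β ^ 2 := pow_pos hLax.β_pos 2
  have h2 : 0 ≤ ω ^ 2 * (S.R * (S.M ^ 2 - S.M₁ ^ 2) - 1) :=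
      mul_nonneg (sq_nonneg _) (sub_nonneg.2 hR)
  have hx : μ.re = 0 := by
    by_contra hx
    rw [(mul_eq_zero.1 (re_mul_im_eq_zero hLax hQ)).resolve_left hx] at hre
    have : 0 < S.β ^ 2 * μ.re ^ 2 := by positivity
    linarith
  rw [hx] at hre
  exact ⟨hx, by linarith⟩

lemma lopatinskiFactor_ne_zero (hLax : S.LaxConditions) (h : S.IsAcousticRoot s ω μ)
    (hs : 0 < s.re) (hμ : 0 ≤ μ.re) : S.lopatinskiFactor ω μ ≠ 0 := by
  rcases lt_or_ge (S.R * (S.M ^ 2 - S.M₁ ^ 2)) 1 with hR | hR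
  · refine lopatinskiFactor_ne_zero_of_lt_one hLax h hs.le hμ (Or.inl ?_) hR
    rintro rfl
    simp at hs
  · exact fun hQ => (h.re_pos hs hμ).ne' (lopatinskiFactor_eq_zero_imp hLax hQ hR).1

variable (S) in
/-- A compact set of triples `(s, ω, μ)` that contains the frequencies of the open unit hemisphere with
their acoustic roots in the right half-plane. The last inequality, automatic when `Re s > 0` and
`Re μ > 0`, says at the boundary `Re s = 0` that the mode does not carry energy away from the front; it
selects the imaginary roots that are limits of roots with positive real part. -/
def incomingFrequencies : Set (ℂ × ℝ × ℂ) :=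
  {x | 0 ≤ x.1.re ∧ 0 ≤ x.2.2.re ∧ ‖x.1‖ ^ 2 + x.2.1 ^ 2 = 1 ∧
    S.IsAcousticRoot x.1 x.2.1 x.2.2 ∧
    S.M ^ 2 * (x.1.im + x.2.2.im) ^ 2 ≤
      (S.Mstar ^ 2 * x.2.2.im + x.2.1 * S.ℓ₀) * (x.1.im + x.2.2.im)}

lemma IsAcousticRoot.mem_incomingFrequencies (h : S.IsAcousticRoot s ω μ) (hs : 0 < s.re)
    (hμ : 0 < μ.re) (hn : ‖s‖ ^ 2 + ω ^ 2 = 1) : (s, ω, μ) ∈ S.incomingFrequencies := by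
  refine ⟨hs.le, hμ.le, hn, h, ?_⟩
  refine le_of_mul_le_mul_left ?_ hμ
  have : 0 ≤ s.re * (S.M ^ 2 * (s.im + μ.im) ^ 2) := by positivity
  have := h.eq_im
  simp only
  rw [← mul_assoc μ.re (_ + _), this]
  linarith

lemma norm_le_of_isAcousticRoot (hLax : S.LaxConditions) (h : S.IsAcousticRoot s ω μ)
    (hn : ‖s‖ ^ 2 + ω ^ 2 = 1) :
    ‖μ‖ ≤ 1 + (2 * (|S.ℓ₀| + S.M ^ 2) + (S.M ^ 2 + (1 + S.M₂ ^ 2))) / S.β ^ 2 := by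
  rw [isAcousticRoot_iff_quadratic hLax] at h
  have hβ : 0 < S.β ^ 2 := pow_pos hLax.β_pos 2
  have hs1 : ‖s‖ ≤ 1 := by nlinarith [norm_nonneg s]
  have hs2 : ‖s‖ ^ 2 ≤ 1 := by nlinarith
  have hω1 : |ω| ≤ 1 := by rw [← sq_le_one_iff_abs_le_one]; nlinarith [norm_nonneg s]
  have hω2 : ω ^ 2 ≤ 1 := by nlinarith [norm_nonneg s]
  by_contra! hcon
  have hpos : 0 ≤ (2 * (|S.ℓ₀| + S.M ^ 2) + (S.M ^ 2 + (1 + S.M₂ ^ 2))) / S.β ^ 2 := by positivity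
  have h1 : (S.β : ℂ) ^ 2 * (μ * μ) = -((2 * (I * ω * S.ℓ₀ - S.M ^ 2 * s)) * μ) +
      ((S.M : ℂ) ^ 2 * s ^ 2 + ω ^ 2 * (1 + (S.M₂ : ℂ) ^ 2)) := by linear_combination h
  have h2 : ‖2 * (I * ω * S.ℓ₀ - S.M ^ 2 * s)‖ ≤ 2 * (|S.ℓ₀| + S.M ^ 2) := by
    rw [norm_mul, norm_ofNat]
    gcongr
    refine (norm_sub_le _ _).trans ?_
    simp only [norm_mul, norm_I, norm_real, Real.norm_eq_abs, norm_pow, one_mul, sq_abs]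
    gcongr
    · exact mul_le_of_le_one_left (abs_nonneg _) hω1
    · exact mul_le_of_le_one_right (sq_nonneg _) hs1
  have h3 : ‖(S.M : ℂ) ^ 2 * s ^ 2 + ω ^ 2 * (1 + (S.M₂ : ℂ) ^ 2)‖ ≤ S.M ^ 2 + (1 + S.M₂ ^ 2) := by
    refine (norm_add_le _ _).trans ?_
    rw [show (1 + (S.M₂ : ℂ) ^ 2) = ((1 + S.M₂ ^ 2 : ℝ) : ℂ) by push_cast; rfl]
    simp only [norm_mul, norm_real, Real.norm_eq_abs, norm_pow, sq_abs]
    rw [abs_of_pos (by positivity)]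
    gcongr
    · exact mul_le_of_le_one_right (sq_nonneg _) hs2
    · exact mul_le_of_le_one_left (by positivity) hω2
  have h4 : S.β ^ 2 * (‖μ‖ * ‖μ‖) ≤ 2 * (|S.ℓ₀| + S.M ^ 2) * ‖μ‖ + (S.M ^ 2 + (1 + S.M₂ ^ 2)) := by
    have := congrArg norm h1
    rw [norm_mul, norm_mul, norm_pow, norm_real, Real.norm_eq_abs, sq_abs] at this
    rw [this]
    refine (norm_add_le _ _).trans ?_
    rw [norm_neg, norm_mul]
    gcongr
  have hμ1 : 1 ≤ ‖μ‖ := by linarith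
  have h5 : S.β ^ 2 * (‖μ‖ * ‖μ‖) ≤
      (2 * (|S.ℓ₀| + S.M ^ 2) + (S.M ^ 2 + (1 + S.M₂ ^ 2))) * ‖μ‖ := by
    refine h4.trans ?_
    rw [add_mul]
    gcongr
    exact le_mul_of_one_le_right (by positivity) hμ1
  have h6 : S.β ^ 2 * ‖μ‖ ≤ 2 * (|S.ℓ₀| + S.M ^ 2) + (S.M ^ 2 + (1 + S.M₂ ^ 2)) := by
    refine le_of_mul_le_mul_right ?_ (by linarith : 0 < ‖μ‖)
    linarith
  have h7 := (le_div_iff₀' hβ).2 h6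
  linarith

lemma isCompact_incomingFrequencies (hLax : S.LaxConditions) :
    IsCompact S.incomingFrequencies := by
  refine Metric.isCompact_of_isClosed_isBounded ?_ ?_
  · unfold incomingFrequencies IsAcousticRoot
    refine IsClosed.and ?_ (IsClosed.and ?_ (IsClosed.and ?_ (IsClosed.and ?_ ?_)))
    · exact isClosed_le (by fun_prop) (by fun_prop)
    · exact isClosed_le (by fun_prop) (by fun_prop)
    · exact isClosed_eq (by fun_prop) (by fun_prop)
    · exact isClosed_eq (by fun_prop) (by fun_prop)
    · exact isClosed_le (by fun_prop) (by fun_prop)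
  · rw [isBounded_iff_forall_norm_le]
    refine ⟨1 + (2 * (|S.ℓ₀| + S.M ^ 2) + (S.M ^ 2 + (1 + S.M₂ ^ 2))) / S.β ^ 2, ?_⟩
    rintro ⟨s, ω, μ⟩ ⟨-, -, hn, h, -⟩
    have hpos : 0 ≤ (2 * (|S.ℓ₀| + S.M ^ 2) + (S.M ^ 2 + (1 + S.M₂ ^ 2))) / S.β ^ 2 := by positivity
    simp only at hn h
    refine max_le ?_ (max_le ?_ (norm_le_of_isAcousticRoot hLax h hn))
    · simp only
      nlinarith [norm_nonneg s]
    · simp only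
      have : |ω| ≤ 1 := by rw [← sq_le_one_iff_abs_le_one]; nlinarith [norm_nonneg s]
      rw [Real.norm_eq_abs]
      linarith

lemma add_ne_zero_of_mem (h : (s, ω, μ) ∈ S.incomingFrequencies) : s + μ ≠ 0 := by
  obtain ⟨hs, hμ, hn, h, -⟩ := h
  simp only at hs hμ hn h
  intro h0
  have h1 := congrArg Complex.re h0
  have h2 := congrArg Complex.im h0
  simp only [add_re, add_im, zero_re, zero_im] at h1 h2
  have hx : μ.re = 0 := by linarith
  have hre := h.eq_re
  rw [h1, h2, hx] at hre
  have hσ := S.σ_pos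
  have hω : ω ^ 2 * S.σ ^ 2 = 0 := le_antisymm (by nlinarith) (by positivity)
  have hω : ω = 0 := by simpa [hσ.ne'] using hω
  have hy : μ.im = 0 := by simpa [hω, S.Mstar_pos.ne'] using hre
  have hs0 : s = 0 := Complex.ext (by simp; linarith) (by simp; linarith)
  simp [hs0, hω] at hn

/-- At a zero on the boundary, `n = M_*² Im μ + ω ℓ₀` has `β |n| ≥ M σ |ω|` by the last condition in
`incomingFrequencies`, whereas `K < K₁ + K₂` gives the opposite strict inequality. -/
lemma lopatinskiFactor_ne_zero_of_mem (hLax : S.LaxConditions)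
    (h : (s, ω, μ) ∈ S.incomingFrequencies) (hK : S.K < S.K₁ + S.K₂) :
    S.lopatinskiFactor ω μ ≠ 0 := by
  have hlam := add_ne_zero_of_mem h
  obtain ⟨hs, hμ, hn, h, hin⟩ := h
  simp only at hs hμ hn h hin
  rcases lt_or_ge (S.R * (S.M ^ 2 - S.M₁ ^ 2)) 1 with hR | hR
  · refine lopatinskiFactor_ne_zero_of_lt_one hLax h hs hμ ?_ hR
    by_contra! h0
    simp [h0] at hn
  intro hQ
  obtain ⟨hx, hy⟩ := lopatinskiFactor_eq_zero_imp hLax hQ hR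
  set k := S.R * (S.M ^ 2 - S.M₁ ^ 2) - 1 with hk
  have hk0 : 0 ≤ k := sub_nonneg.2 hR
  have hA : 0 < S.Mstar ^ 2 := pow_pos S.Mstar_pos 2
  have hM := S.M_pos
  have hβ := hLax.β_pos
  have hσ := S.σ_pos
  have hgap := sub_pos.2 hLax.lt_M_mul_σ
  have hkK : S.Mstar ^ 2 * √k < S.M * S.σ - |S.ℓ₀| * S.β := by
    refine lt_of_pow_lt_pow_left₀ 2 hgap.le ?_
    rw [mul_pow, Real.sq_sqrt hk0, ← pow_mul, mul_comm,
      ← lt_div_iff₀ (pow_pos S.Mstar_pos _)]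
    rw [K, K₁, K₂] at hK
    norm_num
    linarith
  have him := h.eq_im
  have hre := h.eq_re
  rw [hx] at him hre
  rw [zero_mul, add_zero] at him
  set n := S.Mstar ^ 2 * μ.im + ω * S.ℓ₀ with hn_def
  set l₂ := s.im + μ.im with hl₂_def
  have hl₂ : l₂ ≠ 0 := by
    intro hl
    rw [hl] at hre
    have h1 : 0 ≤ S.Mstar ^ 2 * S.M ^ 2 * (s.re + 0) ^ 2 := by positivity
    have h2 : 0 ≤ ω ^ 2 * S.σ ^ 2 := by positivity
    have h3 : s.re = 0 := by
      have : S.Mstar ^ 2 * S.M ^ 2 * (s.re + 0) ^ 2 = 0 := by nlinarith [sq_nonneg n]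
      simpa [hM.ne', S.Mstar_pos.ne'] using this
    exact hlam (Complex.ext (by simp [h3, hx]) hl)
  have hs0 : s.re = 0 := by simpa [hM.ne', hl₂] using him.symm
  rw [hs0] at hre
  have h1 : S.M ^ 2 * |l₂| ≤ |n| := by
    refine le_of_mul_le_mul_right ?_ (abs_pos.2 hl₂)
    rw [mul_assoc, ← sq, sq_abs, ← abs_mul]
    exact hin.trans (le_abs_self _)
  have h2 : (S.M ^ 2) ^ 2 * l₂ ^ 2 ≤ n ^ 2 := by
    have := pow_le_pow_left₀ (by positivity) h1 2
    rwa [mul_pow, sq_abs, sq_abs] at this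
  have h3 : (S.M * S.σ * |ω|) ^ 2 ≤ (S.β * |n|) ^ 2 := by
    rw [mul_pow, mul_pow, mul_pow, sq_abs, sq_abs, hLax.β_sq]
    have := mul_le_mul_of_nonneg_left h2 hA.le
    nlinarith
  have h4 : S.M * S.σ * |ω| ≤ S.β * |n| := (le_abs_self _).trans (abs_le_of_sq_le_sq h3 (by positivity))
  have h5 : S.β * |μ.im| = |ω| * √k := by
    rw [← Real.sqrt_sq_eq_abs ω, ← Real.sqrt_mul (sq_nonneg _), ← hy, Real.sqrt_sq_eq_abs,
      abs_mul, abs_of_pos hβ]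
  have h6 : |n| ≤ S.Mstar ^ 2 * |μ.im| + |ω| * |S.ℓ₀| := by
    refine (abs_add_le _ _).trans ?_
    rw [abs_mul, abs_mul, abs_of_pos hA]
  have h7 : S.β * |n| ≤ |ω| * (S.Mstar ^ 2 * √k + |S.ℓ₀| * S.β) := by
    calc _ ≤ S.β * (S.Mstar ^ 2 * |μ.im| + |ω| * |S.ℓ₀|) := by gcongr
      _ = S.Mstar ^ 2 * (S.β * |μ.im|) + |ω| * (|S.ℓ₀| * S.β) := by ring
      _ = _ := by rw [h5]; ring
  have hω : 0 < |ω| := by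
    refine abs_pos.2 fun hω => ?_
    rw [hω, abs_zero, zero_mul] at h7
    have : |n| = 0 := le_antisymm (nonpos_of_mul_nonpos_right h7 hβ) (abs_nonneg _)
    rw [this] at h1
    exact absurd h1 (not_le.2 (by positivity))
  have h8 := mul_lt_mul_of_pos_left hkK hω
  linarith

/-- Under the hypothesis on `ξ`, the imaginary number `i ξ` is a limit of acoustic roots in the right
half-plane, for frequencies with `Re s > 0`: the root `ε + i ξ` is prescribed, and the dispersion relation is
solved for `s`. -/
lemma exists_isAcousticRoot_near (hLax : S.LaxConditions) {ξ ε : ℝ} (hε : 0 < ε)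
    (hξ : S.M ^ 2 * S.σ ^ 2 ≤ S.β ^ 2 * (S.Mstar ^ 2 * ξ + S.ℓ₀) ^ 2) :
    ∃ s : ℂ, 0 < s.re ∧ S.IsAcousticRoot s 1 (ε + ξ * I) := by
  have hM := S.M_pos
  have hM' : (S.M : ℂ) ≠ 0 := by exact_mod_cast hM.ne'
  obtain ⟨v, hv0, hv⟩ : ∃ v : ℂ, 0 ≤ v.re ∧ v ^ 2 = (S.Mstar : ℂ) ^ 2 * (ε + ξ * I) ^ 2 +
      2 * I * (1 : ℝ) * S.ℓ₀ * (ε + ξ * I) - (1 : ℝ) ^ 2 * (1 + (S.M₂ : ℂ) ^ 2) := by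
    obtain ⟨v, hv⟩ := IsAlgClosed.exists_pow_nat_eq ((S.Mstar : ℂ) ^ 2 * (ε + ξ * I) ^ 2 +
      2 * I * (1 : ℝ) * S.ℓ₀ * (ε + ξ * I) - (1 : ℝ) ^ 2 * (1 + (S.M₂ : ℂ) ^ 2)) two_pos
    rcases le_total 0 v.re with h | h
    · exact ⟨v, h, hv⟩
    · exact ⟨-v, by simpa using h, by rw [neg_sq, hv]⟩
  refine ⟨v / S.M - (ε + ξ * I), ?_, ?_⟩
  swap
  · rw [IsAcousticRoot, ← hv, sub_add_cancel, div_pow, mul_div_cancel₀ _ (pow_ne_zero 2 hM')]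
  have hre := congrArg Complex.re hv
  have him := congrArg Complex.im hv
  simp [sq, ← ofReal_mul] at hre him
  simp only [sub_re, div_ofReal_re, add_re, ofReal_re, mul_re, I_re, ofReal_im, I_im, mul_zero,
    sub_zero, add_zero, mul_one, sub_pos]
  rw [lt_div_iff₀ hM]
  by_contra! hcon
  have hβ := hLax.β_sq
  have hA : 0 < S.Mstar ^ 2 := pow_pos S.Mstar_pos 2
  have hσ := S.σ_sq
  set X := S.Mstar ^ 2 * ξ + S.ℓ₀ with hX
  have h1 : v.re * v.im = ε * X := by rw [hX]; linear_combination him / 2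
  have h2 : S.Mstar ^ 2 * (v.im ^ 2 - v.re ^ 2) = X ^ 2 + S.σ ^ 2 - (S.Mstar ^ 2) ^ 2 * ε ^ 2 := by
    rw [hX, hσ]; linear_combination (-S.Mstar ^ 2) * hre
  have h3 : X ^ 2 ≤ S.M ^ 2 * v.im ^ 2 := by
    refine le_of_mul_le_mul_left ?_ (pow_pos hε 2)
    calc ε ^ 2 * X ^ 2 = v.re ^ 2 * v.im ^ 2 := by rw [← mul_pow, ← h1, mul_pow]
      _ ≤ (ε * S.M) ^ 2 * v.im ^ 2 := by gcongr
      _ = _ := by ring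
  have h4 : v.re ^ 2 ≤ ε ^ 2 * S.M ^ 2 := by rw [← mul_pow]; gcongr
  have h5 := mul_le_mul_of_nonneg_left h3 hA.le
  have h6 := mul_le_mul_of_nonneg_left h4 (mul_pos hA (pow_pos hM 2)).le
  have h7 : 0 < S.M ^ 2 * S.Mstar ^ 2 * S.β ^ 2 * ε ^ 2 := by
    have := hLax.β_pos
    positivity
  rw [hβ] at h7 hξ
  have h8 : S.M ^ 2 * (S.Mstar ^ 2 * (v.im ^ 2 - v.re ^ 2)) =
      S.M ^ 2 * (X ^ 2 + S.σ ^ 2 - (S.Mstar ^ 2) ^ 2 * ε ^ 2) := by rw [h2]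
  linarith

lemma IsAcousticRoot.smul (h : S.IsAcousticRoot s ω μ) (t : ℝ) :
    S.IsAcousticRoot (t * s) (t * ω) (t * μ) := by
  rw [IsAcousticRoot] at h ⊢
  push_cast
  linear_combination (t : ℂ) ^ 2 * h

/-- The zero `i ξ` of the Lopatinski factor at `ω = 1` is `ξ = ± √(R (M² - M₁²) - 1) / β`, with the sign
of `ℓ₀`, so that `|M_*² ξ + ℓ₀|` is as large as possible. -/
lemma exists_lopatinskiFactor_small (hLax : S.LaxConditions) (hK : S.K₁ + S.K₂ ≤ S.K) {η : ℝ}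
    (hη : 0 < η) : ∃ (s : ℂ) (ω : ℝ) (μ : ℂ), 0 < s.re ∧ 0 < μ.re ∧ ‖s‖ ^ 2 + ω ^ 2 = 1 ∧
      S.IsAcousticRoot s ω μ ∧ ‖S.lopatinskiFactor ω μ‖ < η := by
  set k := S.R * (S.M ^ 2 - S.M₁ ^ 2) - 1 with hk
  have hβ := hLax.β_pos
  have hA : 0 < S.Mstar ^ 2 := pow_pos S.Mstar_pos 2
  have hMσ : 0 < S.M * S.σ := mul_pos S.M_pos S.σ_pos
  have hkK : S.K₁ ≤ k := by rw [K, K₂] at hK; linarith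
  have hk0 : 0 ≤ k := le_trans (by rw [K₁]; positivity) hkK
  have hsqrt : S.M * S.σ ≤ S.Mstar ^ 2 * √k + |S.ℓ₀| * S.β := by
    rw [← sub_le_iff_le_add]
    refine (le_abs_self _).trans (abs_le_of_sq_le_sq ?_ (by positivity))
    rw [mul_pow, Real.sq_sqrt hk0, ← pow_mul, mul_comm (S.Mstar ^ _),
      ← div_le_iff₀ (pow_pos S.Mstar_pos _)]
    exact hkK
  obtain ⟨ξ, hξk, hξ⟩ : ∃ ξ : ℝ, S.β ^ 2 * ξ ^ 2 = k ∧
      S.M * S.σ ≤ S.β * |S.Mstar ^ 2 * ξ + S.ℓ₀| := by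
    have hsq : S.β ^ 2 * (√k / S.β) ^ 2 = k := by
      rw [div_pow, Real.sq_sqrt hk0, mul_div_cancel₀ _ (by positivity)]
    have hmul : S.β * (√k / S.β) = √k := mul_div_cancel₀ _ hβ.ne'
    rcases le_total 0 S.ℓ₀ with hl | hl
    · refine ⟨√k / S.β, hsq, hsqrt.trans ?_⟩
      rw [abs_of_nonneg hl]
      refine le_trans (le_of_eq ?_) (mul_le_mul_of_nonneg_left (le_abs_self _) hβ.le)
      linear_combination (-S.Mstar ^ 2) * hmul
    · refine ⟨-(√k / S.β), by rw [neg_sq, hsq], hsqrt.trans ?_⟩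
      rw [abs_of_nonpos hl]
      refine le_trans (le_of_eq ?_) (mul_le_mul_of_nonneg_left (neg_le_abs _) hβ.le)
      linear_combination (-S.Mstar ^ 2) * hmul
  have hξ2 : S.M ^ 2 * S.σ ^ 2 ≤ S.β ^ 2 * (S.Mstar ^ 2 * ξ + S.ℓ₀) ^ 2 := by
    rw [← mul_pow, ← sq_abs (S.Mstar ^ 2 * ξ + S.ℓ₀), ← mul_pow]
    gcongr
  have hlim : Filter.Tendsto (fun ε : ℝ => ‖S.lopatinskiFactor 1 (ε + ξ * I)‖)
      (nhdsWithin 0 (Set.Ioi 0)) (nhds 0) := by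
    have hcont : Continuous fun ε : ℝ => ‖S.lopatinskiFactor 1 (ε + ξ * I)‖ := by
      unfold lopatinskiFactor
      fun_prop
    have h0 : ‖S.lopatinskiFactor 1 ((0 : ℝ) + ξ * I)‖ = 0 := by
      rw [norm_eq_zero, lopatinskiFactor]
      have := congrArg (fun x : ℝ => (x : ℂ)) (hξk.trans hk)
      push_cast at this ⊢
      linear_combination (S.β : ℂ) ^ 2 * ξ ^ 2 * I_sq - this
    have := (hcont.tendsto 0).mono_left (nhdsWithin_le_nhds (s := Set.Ioi 0))
    rwa [h0] at this
  obtain ⟨ε, hεη, hε⟩ := ((hlim.eventually_lt_const hη).and self_mem_nhdsWithin).exists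
  obtain ⟨s, hs, hroot⟩ := exists_isAcousticRoot_near hLax hε hξ2
  set t := 1 / √(‖s‖ ^ 2 + 1) with ht
  have hden : 0 < √(‖s‖ ^ 2 + 1) := Real.sqrt_pos.2 (by positivity)
  have ht0 : 0 < t := by positivity
  have ht2 : t ^ 2 * (‖s‖ ^ 2 + 1) = 1 := by
    rw [ht, div_pow, Real.sq_sqrt (by positivity)]
    field_simp
  have ht1 : t ^ 2 ≤ 1 := by linarith [mul_nonneg (sq_nonneg t) (sq_nonneg ‖s‖)]
  refine ⟨t * s, t * 1, t * (ε + ξ * I), by simpa using mul_pos ht0 hs,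
    by simpa using mul_pos ht0 hε, ?_, hroot.smul t, ?_⟩
  · rw [norm_mul, norm_real, Real.norm_eq_abs, mul_pow, sq_abs]
    linarith
  · have : S.lopatinskiFactor (t * 1) (t * (ε + ξ * I)) =
        (t : ℂ) ^ 2 * S.lopatinskiFactor 1 (ε + ξ * I) := by
      rw [lopatinskiFactor, lopatinskiFactor]; push_cast; ring
    rw [this, norm_mul, norm_pow, norm_real, Real.norm_eq_abs, sq_abs]
    exact (mul_le_of_le_one_left (norm_nonneg _) ht1).trans_lt hεη

end RectilinearShock

/-! ### The Lopatinski conditions -/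

lemma norm_dotProduct_le {ι : Type*} [Fintype ι] (u v : ι → ℂ) :
    ‖u ⬝ᵥ v‖ ≤ Fintype.card ι * (‖u‖ * ‖v‖) := by
  refine (norm_sum_le _ _).trans ?_
  refine (Finset.sum_le_card_nsmul _ _ (‖u‖ * ‖v‖) fun i _ => ?_).trans_eq (by simp)
  rw [norm_mul]
  gcongr <;> exact norm_le_pi_norm _ i

lemma exists_forall_norm_mulVec_le {ι κ : Type*} [Fintype ι] [Fintype κ] (A : Matrix κ ι ℂ) :
    ∃ C : ℝ, 0 < C ∧ ∀ x, ‖A *ᵥ x‖ ≤ C * ‖x‖ := by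
  classical
  let f := LinearMap.toContinuousLinearMap (Matrix.toLin' A)
  exact ⟨‖f‖ + 1, by positivity, fun x => (f.le_opNorm x).trans (by gcongr; linarith)⟩

namespace RectilinearShock
variable {S : RectilinearShock} {s : ℂ} {ω : ℝ} {μ : ℂ}

/-- The boundary operator measures the deviation of `V` from the value prescribed by the front. -/
lemma boundarySymbol_eq (hLax : S.LaxConditions) (s : ℂ) (ω : ℝ) (V : Fin 7 → ℂ) (χ : ℂ) :
    S.linearizedProblem.boundarySymbol s ω V χ =
      S.linearizedProblem.B.map (algebraMap ℝ ℂ) *ᵥ (V - χ • S.frontMode s ω) := by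
  have h := boundarySymbol_frontMode hLax s ω
  unfold LinearizedShockProblem.boundarySymbol at h ⊢
  rw [mulVec_sub, mulVec_smul, eq_neg_of_add_eq_zero_left h, sub_eq_add_neg]
  congr 1
  funext k
  simp

lemma eq_zero_of_B_mulVec_eq_zero (hLax : S.LaxConditions) {x : Fin 7 → ℂ}
    (h : S.linearizedProblem.B.map (algebraMap ℝ ℂ) *ᵥ x = 0) : x = 0 := by
  by_contra hx
  exact (isUnit_B hLax).ne_zero (exists_mulVec_eq_zero_iff.1 ⟨x, hx, h⟩)

lemma exists_forall_norm_le_B_mulVec (hLax : S.LaxConditions) : ∃ C : ℝ, 0 < C ∧ ∀ x,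
    ‖x‖ ≤ C * ‖S.linearizedProblem.B.map (algebraMap ℝ ℂ) *ᵥ x‖ := by
  obtain ⟨C, hC, h⟩ := exists_forall_norm_mulVec_le (S.linearizedProblem.B.map (algebraMap ℝ ℂ))⁻¹
  refine ⟨C, hC, fun x => ?_⟩
  have := h (S.linearizedProblem.B.map (algebraMap ℝ ℂ) *ᵥ x)
  rwa [mulVec_mulVec, nonsing_inv_mul _ (isUnit_B hLax), one_mulVec] at this

lemma front_coeff_ne_zero : ((1 : ℂ) - S.R) / S.R ≠ 0 := by
  have h1 := S.R_pos.ne'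
  have h2 := sub_ne_zero.2 S.R_ne_one.symm
  exact_mod_cast div_ne_zero h2 h1

theorem lopatinskiCondition (hLax : S.LaxConditions) :
    S.linearizedProblem.LopatinskiCondition := by
  intro s ω hs V hV χ hb
  obtain ⟨μ, hroot, hμ⟩ := exists_isAcousticRoot hLax hs ω
  rw [hroot.mem_stableSubspace_iff hLax hs hμ.le] at hV
  rw [boundarySymbol_eq hLax] at hb
  have hVχ := sub_eq_zero.1 (eq_zero_of_B_mulVec_eq_zero hLax hb)
  rw [hVχ, dotProduct_smul, hroot.covector_dot_frontMode hLax, smul_eq_mul] at hV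
  have hlam : s + μ ≠ 0 := by
    intro h
    have := congrArg Complex.re h
    simp at this
    linarith
  have hχ : χ = 0 := (mul_eq_zero.1 hV).resolve_right (mul_ne_zero front_coeff_ne_zero
    (mul_ne_zero hlam (lopatinskiFactor_ne_zero hLax hroot hs hμ.le)))
  exact ⟨by rw [hVχ, hχ, zero_smul], hχ⟩

@[fun_prop]
lemma continuous_acousticCovector :
    Continuous fun x : ℂ × ℝ × ℂ => S.acousticCovector x.1 x.2.1 x.2.2 := by
  unfold acousticCovector
  refine Continuous.matrix_mulVec continuous_const (continuous_pi fun k => ?_)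
  fin_cases k <;> simp [acousticMode] <;> fun_prop

@[fun_prop]
lemma continuous_frontMode : Continuous fun x : ℂ × ℝ × ℂ => S.frontMode x.1 x.2.1 := by
  refine continuous_pi fun k => ?_
  fin_cases k <;> simp [frontMode] <;> fun_prop

theorem uniformlyStable (hLax : S.LaxConditions) (hK : S.K < S.K₁ + S.K₂) :
    S.UniformlyStable := by
  have hcomp := isCompact_incomingFrequencies hLax
  obtain ⟨δ, hδ, hδ'⟩ := hcomp.exists_forall_le' (a := 0)
    (f := fun x => ‖S.acousticCovector x.1 x.2.1 x.2.2 ⬝ᵥ S.frontMode x.1 x.2.1‖)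
    (Continuous.continuousOn (by fun_prop)) (by
      rintro ⟨s, ω, μ⟩ h
      rw [norm_pos_iff, h.2.2.2.1.covector_dot_frontMode hLax]
      exact mul_ne_zero front_coeff_ne_zero (mul_ne_zero (add_ne_zero_of_mem h)
        (lopatinskiFactor_ne_zero_of_mem hLax h hK)))
  obtain ⟨L, hL⟩ := hcomp.exists_bound_of_continuousOn
    (f := fun x => S.acousticCovector x.1 x.2.1 x.2.2) (Continuous.continuousOn (by fun_prop))
  obtain ⟨W, hW⟩ := hcomp.exists_bound_of_continuousOn
    (f := fun x => S.frontMode x.1 x.2.1) (Continuous.continuousOn (by fun_prop))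
  obtain ⟨C, hC, hB⟩ := exists_forall_norm_le_B_mulVec hLax
  set T := (1 + |W|) * (7 * (|L| * C) / δ) + C with hT
  have hT0 : 0 < T := by positivity
  refine ⟨1 / T, by positivity, fun s ω hs hn V hV χ => ?_⟩
  obtain ⟨μ, hroot, hμ⟩ := exists_isAcousticRoot hLax hs ω
  have hmem := hroot.mem_incomingFrequencies hs hμ hn
  rw [hroot.mem_stableSubspace_iff hLax hs hμ.le] at hV
  rw [boundarySymbol_eq hLax, div_mul_eq_mul_div, one_mul, div_le_iff₀' hT0]
  have h1 := hδ' _ hmem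
  have h2 := (hL _ hmem).trans (le_abs_self _)
  have h3 := (hW _ hmem).trans (le_abs_self _)
  have h4 := hB (V - χ • S.frontMode s ω)
  simp only at h1 h2 h3
  set x := V - χ • S.frontMode s ω with hx
  set b := ‖S.linearizedProblem.B.map (algebraMap ℝ ℂ) *ᵥ x‖ with hb
  have hVx : V = x + χ • S.frontMode s ω := by rw [hx, sub_add_cancel]
  have h5 : ‖χ‖ * δ ≤ 7 * (|L| * C) * b := by
    rw [hVx, dotProduct_add, dotProduct_smul, smul_eq_mul, add_eq_zero_iff_neg_eq] at hV
    calc ‖χ‖ * δ ≤ ‖χ‖ * ‖S.acousticCovector s ω μ ⬝ᵥ S.frontMode s ω‖ := by gcongr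
      _ = ‖S.acousticCovector s ω μ ⬝ᵥ x‖ := by rw [← norm_mul, ← hV, norm_neg]
      _ ≤ 7 * (‖S.acousticCovector s ω μ‖ * ‖x‖) := by simpa using norm_dotProduct_le _ x
      _ ≤ 7 * (|L| * (C * b)) := by gcongr
      _ = _ := by ring
  have h6 : ‖χ‖ ≤ 7 * (|L| * C) / δ * b := by
    rw [div_mul_eq_mul_div, le_div_iff₀ hδ]
    exact h5
  have h7 : ‖V‖ ≤ C * b + ‖χ‖ * |W| := by
    rw [hVx]
    refine (norm_add_le _ _).trans ?_
    rw [norm_smul]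
    gcongr
  calc ‖V‖ + ‖χ‖ ≤ C * b + (1 + |W|) * ‖χ‖ := by linarith
    _ ≤ C * b + (1 + |W|) * (7 * (|L| * C) / δ * b) := by gcongr
    _ = T * b := by rw [hT]; ring

lemma acousticCovector_ne_zero_of_mem (hLax : S.LaxConditions)
    (h : (s, ω, μ) ∈ S.incomingFrequencies) : S.acousticCovector s ω μ ≠ 0 := by
  intro h0
  have hmode : S.acousticMode s ω μ = 0 := by
    by_contra hne
    exact (isUnit_A₁ hLax).ne_zero (exists_mulVec_eq_zero_iff.1 ⟨_, hne, h0⟩)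
  have hlam := add_ne_zero_of_mem h
  have h1 : μ = 0 := by simpa [acousticMode, hlam] using congrFun hmode 1
  have h2 : ω = 0 := by simpa [acousticMode, hlam] using congrFun hmode 2
  obtain ⟨-, -, hn, hroot, -⟩ := h
  simp only at hn hroot
  subst h1 h2
  simp [hroot.eq_zero_of_zero] at hn

/-- At frequencies where the Lopatinski factor is small, the front mode is close to the stable
subspace; correcting one coordinate moves it into the subspace. -/
theorem not_uniformlyStable (hLax : S.LaxConditions) (hK : S.K₁ + S.K₂ ≤ S.K) :
    ¬ S.UniformlyStable := by
  rintro ⟨c, hc, hunif⟩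
  have hcomp := isCompact_incomingFrequencies hLax
  obtain ⟨δ, hδ, hδ'⟩ := hcomp.exists_forall_le' (a := 0)
    (f := fun x => ‖S.acousticCovector x.1 x.2.1 x.2.2‖)
    (Continuous.continuousOn (by fun_prop))
    (fun x h => norm_pos_iff.2 (acousticCovector_ne_zero_of_mem hLax h))
  obtain ⟨L, hL⟩ := hcomp.exists_bound_of_continuousOn
    (f := fun x => ((1 : ℂ) - S.R) / S.R * (x.1 + x.2.2)) (Continuous.continuousOn (by fun_prop))
  obtain ⟨C, hC, hB⟩ :=
    exists_forall_norm_mulVec_le (S.linearizedProblem.B.map (algebraMap ℝ ℂ))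
  obtain ⟨s, ω, μ, hs, hμ, hn, hroot, hη⟩ := exists_lopatinskiFactor_small hLax hK
    (η := c * δ / (C * (|L| + 1))) (by positivity)
  have hmem := hroot.mem_incomingFrequencies hs hμ hn
  have h1 := hδ' _ hmem
  have h2 := (hL _ hmem).trans (le_abs_self _)
  simp only at h1 h2
  obtain ⟨i, hi⟩ : ∃ i, δ ≤ ‖S.acousticCovector s ω μ i‖ := by
    by_contra! hlt
    exact absurd h1 (not_le.2 ((pi_norm_lt_iff hδ).2 hlt))
  have hi0 : S.acousticCovector s ω μ i ≠ 0 := norm_pos_iff.1 (hδ.trans_le hi)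
  set e := S.acousticCovector s ω μ ⬝ᵥ S.frontMode s ω with he
  set x : Fin 7 → ℂ := Pi.single i (-(e / S.acousticCovector s ω μ i)) with hx
  have hV : x + S.frontMode s ω ∈ S.linearizedProblem.stableSubspace s ω := by
    rw [hroot.mem_stableSubspace_iff hLax hs hμ.le, dotProduct_add, ← he, hx, dotProduct_single]
    field_simp
    ring
  have h3 := hunif s ω hs hn _ hV 1
  rw [boundarySymbol_eq hLax, one_smul, add_sub_cancel_right, norm_one] at h3
  have hxn : ‖x‖ * δ ≤ ‖e‖ := by
    have : ‖x‖ = ‖e‖ / ‖S.acousticCovector s ω μ i‖ := by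
      rw [hx, Pi.norm_single, norm_neg, norm_div]
    rw [this, div_mul_eq_mul_div, div_le_iff₀ (hδ.trans_le hi)]
    gcongr
  have hen : ‖e‖ ≤ (|L| + 1) * ‖S.lopatinskiFactor ω μ‖ := by
    rw [he, hroot.covector_dot_frontMode hLax, ← mul_assoc, norm_mul]
    gcongr
    linarith
  rw [lt_div_iff₀ (by positivity)] at hη
  have h4 : c ≤ C * ‖x‖ := by
    refine le_trans ?_ (h3.trans (hB x))
    refine le_mul_of_one_le_right hc.le ?_
    linarith [norm_nonneg (x + S.frontMode s ω)]
  have h5 : c * δ ≤ C * ((|L| + 1) * ‖S.lopatinskiFactor ω μ‖) := by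
    calc c * δ ≤ C * ‖x‖ * δ := by gcongr
      _ = C * (‖x‖ * δ) := by ring
      _ ≤ _ := mul_le_mul_of_nonneg_left (hxn.trans hen) hC.le
  linarith

end RectilinearShock

end

theorem theorem1 (S : RectilinearShock) (hLax : S.LaxConditions) :
    (S.UniformlyStable ↔ S.StabilityInequality) ∧
    (S.StabilityInequality ↔ S.K < S.K₁ + S.K₂) ∧
    (¬ S.StabilityInequality → S.WeaklyStable) ∧
    ¬ S.ViolentlyUnstable := by
  have hiff := hLax.stabilityInequality_iff
  refine ⟨?_, hiff, fun h => ⟨S.lopatinskiCondition hLax, ?_⟩, fun h => h (S.lopatinskiCondition hLax)⟩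
  · rw [hiff]
    exact ⟨fun h => by_contra fun hK => S.not_uniformlyStable hLax (not_lt.1 hK) h,
      S.uniformlyStable hLax⟩
  · rw [hiff, not_lt] at h
    exact S.not_uniformlyStable hLax h
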